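/- Let $K\in\mathbb N$, let $\lambda,\nu,\mu>0$ and $T>0$ be real numbers, let $\chi=\{(w,x,y,z)\in\mathbb N^4:\ w+x+y+z\le K\}$, and let $\mathcal D_T$ be the set of cadlag functions from $[0,T]$ to $\chi$. On a probability space $(\Omega,\mathbb P)$, let $\overline{\mathcal N}_{\lambda,1},\overline{\mathcal N}_{\lambda,2}$ be Poisson processes on $\mathbb R_+^2$ with intensity $\lambda\,dt\,dh$, let $\overline{\mathcal N}_{\nu,1},\overline{\mathcal N}_{\nu,2}$ be Poisson processes on $\mathbb R_+^2$ with intensity $\nu\,dt\,dh$, and let $\mathcal N_{\mu,l}$, $l\ge 1$, be Poisson processes on $\mathbb R_+$ with intensity $\mu\,dt$, all these processes being independent. Then, for every $(w,x,y,z)\in\chi$, the following system of equations, where $S=R^r+R+V+V^r$, $f(s^-)$ is the left limit of $f$ at $s$, with $f(0^-)=f(0)$, and $t$ ranges over $[0,T]$, has a unique solution $Z=(R^r,R,V,V^r)$ with paths in $\mathcal D_T$: \begin{align*} R^r(t)&=w+\iint_{[0,t]\times\mathbb R_+}\mathbf 1_{\{0\le h\le \mathbf 1_{\{S(s^-)<K\}}\mathbb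 P(V(s^-)>0)\}}\,\overline{\mathcal N}_{\lambda,1}(ds,dh)-\iint_{[0,t]\times\mathbb R_+}\mathbf 1_{\{0\le h\le R^r(s^-)\}}\,\overline{\mathcal N}_{\nu,1}(ds,dh),\\ R(t)&=x+\iint_{[0,t]\times\mathbb R_+}\mathbf 1_{\{0\le h\le R^r(s^-)\}}\,\overline{\mathcal N}_{\nu,1}(ds,dh)-\int_{[0,t]}\sum_{l=1}^{\infty}\mathbf 1_{\{l\le R(s^-)\}}\,\mathcal N_{\mu,l}(ds),\\ V(t)&=y+\int_{[0,t]}\sum_{l=1}^{\infty}\mathbf 1_{\{l\le R(s^-)\}}\,\mathcal N_{\mu,l}(ds)-\iint_{[0,t]\times\mathbb R_+}\mathbf 1_{\{0\le h\le \mathbf 1_{\{V(s^-)>0\}}\mathbb P(S(s^-)<K)\}}\,\overline{\mathcal N}_{\lambda,2}(ds,dh),\\ V^r(t)&=z+\iint_{[0,t]\times\mathbb R_+}\mathbf 1_{\{0\le h\le \mathbf 1_{\{V(s^-)>0\}}\mathbb P(S(s^-)<K)\}}\,\overline{\mathcal N}_{\lambda,2}(ds,dh)-\iint_{[0,t]\times\mathbb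 R_+}\mathbf 1_{\{0\le h\le V^r(s^-)\}}\,\overline{\mathcal N}_{\nu,2}(ds,dh). \end{align*} That is: there is a process $Z$ with paths in $\mathcal D_T$ for which, almost surely, all the integrals are finite and the equations hold for all $t\in[0,T]$; any two such processes on the same probability space with the same driving Poisson processes are almost surely equal on the whole of $[0,T]$; and the law of the solution on path space is the same for all choices of the probability space and of the driving Poisson processes. -/

import Mathlib

open MeasureTheory ProbabilityTheory Filter Set
open scoped NNReal ENNReal Topology

noncomputable section

namespace CarSharing

/-- A quadruple `(r^r, r, v, v^r)` of natural numbers, indexed by `0, 1, 2, 3`: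
parking spaces reserved by non-driving users, parking spaces reserved by driving users,
available cars, reserved cars. -/
abbrev State : Type := Fin 4 → ℕ

/-- The number `r^r + r + v + v^r` of unavailable parking spaces in a state. -/
def total (q : State) : ℕ := ∑ i, q i

/-- The state space `χ` of a station with capacity `K`. -/
def chi (K : ℕ) : Set State := {q | total q ≤ K}

/-- Cadlag functions on `[0, T]`: right-continuous on `[0, T)`, with left limits on `(0, T]`.
Only the values of the function on `[0, T]` matter. -/
def IsCadlagOn (T : ℝ) (f : ℝ → State) : Prop :=
  (∀ t ∈ Ico 0 T, ContinuousWithinAt f (Ici t) t) ∧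
  (∀ t ∈ Ioc 0 T, ∃ q, Tendsto f (𝓝[<] t) (𝓝 q))

/-- The value `f (s-)` just before `s`: the left limit if `s > 0`, with the usual convention
`f (0-) = f 0`. -/
def before (f : ℝ → State) (s : ℝ) : State :=
  if 0 < s then Function.leftLim f s else f 0

/-- `N` is a Poisson point process (Poisson random measure) on `E` with intensity `m`,
on the probability space `(Ω, P)`. -/
structure IsPoissonProcess {Ω E : Type*} [MeasurableSpace Ω] [MeasurableSpace E]
    (P : Measure Ω) (N : Ω → Measure E) (m : Measure E) : Prop where
  /-- `N` is a random measure. -/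
  measurable : Measurable N
  /-- Almost surely, `N` takes values in `{0, 1, 2, …, ∞}`. -/
  counting : ∀ᵐ ω ∂P, ∀ A, MeasurableSet A → ∃ n : ℕ∞, N ω A = (n : ℝ≥0∞)
  /-- The number of points in a set of finite intensity is a Poisson variable. -/
  law : ∀ A, MeasurableSet A → m A ≠ ∞ →
    P.map (fun ω => N ω A) =
      (poissonMeasure (m A).toNNReal).map (fun n : ℕ => (n : ℝ≥0∞))
  /-- The numbers of points in disjoint sets are independent. -/
  indep : ∀ (n : ℕ) (A : Fin n → Set E), (∀ i, MeasurableSet (A i)) →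
    Pairwise (Function.onFun Disjoint A) → iIndepFun (fun i ω => N ω (A i)) P

/-- The intensity `ξ dt` on `ℝ₊`. -/
def lineIntensity (ξ : ℝ≥0) : Measure ℝ := ξ • volume.restrict (Ici 0)

/-- The intensity `ξ dt dh` on `ℝ₊²`. -/
def planeIntensity (ξ : ℝ≥0) : Measure (ℝ × ℝ) := ξ • volume.restrict (Ici 0 ×ˢ Ici 0)

/-- The random measures that drive the system: `lam1`, `lam2` (rate `lam`), `nu1`, `nu2`
(rate `nu`) on `ℝ₊²` and `mu l`, `l = 0, 1, 2, …`, on `ℝ₊`. (The processes on `ℝ₊` are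
numbered from `0` here, instead of from `1`.) -/
structure Drivers (Ω : Type*) where
  lam1 : Ω → Measure (ℝ × ℝ)
  lam2 : Ω → Measure (ℝ × ℝ)
  nu1 : Ω → Measure (ℝ × ℝ)
  nu2 : Ω → Measure (ℝ × ℝ)
  mu : ℕ → Ω → Measure ℝ

/-- The driving measures are independent Poisson processes with the prescribed intensities. -/
structure Drivers.IsPoisson {Ω : Type*} [MeasurableSpace Ω] (D : Drivers Ω) (P : Measure Ω)
    (lam nu mu : ℝ≥0) : Prop where
  lam1 : IsPoissonProcess P D.lam1 (planeIntensity lam)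
  lam2 : IsPoissonProcess P D.lam2 (planeIntensity lam)
  nu1 : IsPoissonProcess P D.nu1 (planeIntensity nu)
  nu2 : IsPoissonProcess P D.nu2 (planeIntensity nu)
  mu : ∀ l, IsPoissonProcess P (D.mu l) (lineIntensity mu)
  /-- All the processes are mutually independent. -/
  indep : iIndep
    (Sum.elim
      ![MeasurableSpace.comap D.lam1 inferInstance, MeasurableSpace.comap D.lam2 inferInstance,
        MeasurableSpace.comap D.nu1 inferInstance, MeasurableSpace.comap D.nu2 inferInstance]
      (fun l : ℕ => MeasurableSpace.comap (D.mu l) inferInstance)) P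

/-- The integral of `1_{0 ≤ h ≤ c s}` over `(s, h) ∈ [0, t] × ℝ₊` against the measure `M`. -/
def thinned (M : Measure (ℝ × ℝ)) (c : ℝ → ℝ) (t : ℝ) : ℝ≥0∞ :=
  M {p | 0 ≤ p.1 ∧ p.1 ≤ t ∧ 0 ≤ p.2 ∧ p.2 ≤ c p.1}

section Terms

variable {Ω : Type*} [MeasurableSpace Ω]

/-- `1_{S(s-) < K} ℙ(V(s-) > 0)` -/
def spaceRate (P : Measure Ω) (K : ℕ) (Z : ℝ → Ω → State) (ω : Ω) (s : ℝ) : ℝ :=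
  if total (before (fun u => Z u ω) s) < K then
    P.real {ω' | 0 < before (fun u => Z u ω') s 2} else 0

/-- `1_{V(s-) > 0} ℙ(S(s-) < K)` -/
def carRate (P : Measure Ω) (K : ℕ) (Z : ℝ → Ω → State) (ω : Ω) (s : ℝ) : ℝ :=
  if 0 < before (fun u => Z u ω) s 2 then
    P.real {ω' | total (before (fun u => Z u ω') s) < K} else 0

/-- Parking spaces of the station reserved during `[0, t]`. -/
def spaceReservations (P : Measure Ω) (D : Drivers Ω) (K : ℕ) (Z : ℝ → Ω → State)
    (ω : Ω) (t : ℝ) : ℝ≥0∞ :=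
  thinned (D.lam1 ω) (spaceRate P K Z ω) t

/-- Users with a reserved space at the station who start driving during `[0, t]`. -/
def departuresToStation (D : Drivers Ω) (Z : ℝ → Ω → State) (ω : Ω) (t : ℝ) : ℝ≥0∞ :=
  thinned (D.nu1 ω) (fun s => (before (fun u => Z u ω) s 0 : ℝ)) t

/-- Cars returned during `[0, t]`: the sum over `l ≥ 1` of the integrals over `[0, t]` of
`1_{l ≤ R(s-)}` against the `l`-th Poisson process on `ℝ₊`. -/
def returns (D : Drivers Ω) (Z : ℝ → Ω → State) (ω : Ω) (t : ℝ) : ℝ≥0∞ :=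
  ∑' l : ℕ, D.mu l ω {s | 0 ≤ s ∧ s ≤ t ∧ l + 1 ≤ before (fun u => Z u ω) s 1}

/-- Cars of the station reserved during `[0, t]`. -/
def carReservations (P : Measure Ω) (D : Drivers Ω) (K : ℕ) (Z : ℝ → Ω → State)
    (ω : Ω) (t : ℝ) : ℝ≥0∞ :=
  thinned (D.lam2 ω) (carRate P K Z ω) t

/-- Reserved cars of the station picked up during `[0, t]`. -/
def pickUps (D : Drivers Ω) (Z : ℝ → Ω → State) (ω : Ω) (t : ℝ) : ℝ≥0∞ :=
  thinned (D.nu2 ω) (fun s => (before (fun u => Z u ω) s 3 : ℝ)) t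

/-- `Z = (R^r, R, V, V^r)` is a solution on `[0, T]`, with initial state `q`, of the system driven
by `D`: a process with cadlag paths in `χ` such that, almost surely, for all `t ∈ [0, T]`, the
stochastic integrals are finite and the four evolution equations hold. -/
structure IsSolution (P : Measure Ω) (D : Drivers Ω) (K : ℕ) (T : ℝ) (q : State)
    (Z : ℝ → Ω → State) : Prop where
  measurable : ∀ t ∈ Icc 0 T, Measurable (Z t)
  mem_chi : ∀ ω, ∀ t ∈ Icc 0 T, Z t ω ∈ chi K
  cadlag : ∀ ω, IsCadlagOn T (fun t => Z t ω)
  finite : ∀ᵐ ω ∂P, ∀ t ∈ Icc 0 T,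
    spaceReservations P D K Z ω t ≠ ∞ ∧ departuresToStation D Z ω t ≠ ∞ ∧
    returns D Z ω t ≠ ∞ ∧ carReservations P D K Z ω t ≠ ∞ ∧ pickUps D Z ω t ≠ ∞
  equations : ∀ᵐ ω ∂P, ∀ t ∈ Icc 0 T,
    (Z t ω 0 : ℝ) = q 0 + (spaceReservations P D K Z ω t).toReal
      - (departuresToStation D Z ω t).toReal ∧
    (Z t ω 1 : ℝ) = q 1 + (departuresToStation D Z ω t).toReal - (returns D Z ω t).toReal ∧
    (Z t ω 2 : ℝ) = q 2 + (returns D Z ω t).toReal - (carReservations P D K Z ω t).toReal ∧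
    (Z t ω 3 : ℝ) = q 3 + (carReservations P D K Z ω t).toReal - (pickUps D Z ω t).toReal

/-- The law of the process `(Z t, 0 ≤ t ≤ T)`, as a measure on the space of paths with the
`σ`-algebra generated by the coordinates (on cadlag paths, this is the Borel `σ`-algebra of the
Skorohod topology). -/
def pathLaw (P : Measure Ω) (T : ℝ) (Z : ℝ → Ω → State) : Measure (Icc (0 : ℝ) T → State) :=
  P.map (fun ω t => Z t ω)

end Terms

end CarSharing

end

/-!
The only nonlinear terms of the system are the deterministic functions `ℙ(V(s-) > 0)` and
`ℙ(S(s-) < K)`, here a function `ρ : ℝ → ℝ × ℝ`. For a given `ρ`, the solution is a deterministic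
function of the driving measures: up to time `T` only finitely many points matter, almost surely no
two of them are simultaneous, and the jumps are executed one after the other. This function is
obtained by Picard iteration for the path of left limits (`Dynamics.picard`), which makes its
joint measurability evident; `IsSimple.path_eq` and `IsSimple.reached_mem` say that it solves the
equations and stays in the state space.

The heart of the matter is a coupling (`NoGap`). Solutions for `ρ` and `ρ'` with the same driving
measures can only begin to differ at a point `(s, h)` of one of the two measures of reservations
with `h` between the values of `ρ` and `ρ'` at `s`. This region of the plane is *deterministic*, so
the solutions differ up to time `t` with probability at most `λ ∫₀ᵗ ‖ρ - ρ'‖₁`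
(`GapBound.measure_not_noGap_le`); neither adaptedness nor compensators are needed. Since a change
of a random state on an event of small probability changes its mean field little, the map that takes
`ρ` to the mean field of its solution satisfies an inequality of Volterra type. Its iterates
converge to a fixed point (`GapBound.exists_meanField`), which yields a solution, and by Grönwall's
inequality two solutions have the same mean field and therefore almost surely the same paths
(`GapBound.ae_eq`).

The fixed point and the solution depend on the driving measures only through their joint law, which
is the product of the laws of independent Poisson processes of finite intensity, and these are
determined by the intensities (`IsPoissonProcess.map_eq`). Hence the uniqueness of the law.
-/

noncomputable section

namespace CarSharing

/-! ### Real induction and the Volterra inequality -/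

/-- Induction along `[0, T]`: by `left` the infimum of the times where `p` fails satisfies `p`, which
contradicts `right`. -/
theorem forall_mem_Icc_of_step {p : ℝ → Prop} {T : ℝ}
    (left : ∀ t ∈ Icc 0 T, (∀ u ∈ Ico 0 t, p u) → p t)
    (right : ∀ t ∈ Ico 0 T, p t → ∃ ε > 0, ∀ u ∈ Ioo t (t + ε), p u) :
    ∀ t ∈ Icc 0 T, p t := by
  by_contra! h
  obtain ⟨b, hb, hpb⟩ := h
  set B : Set ℝ := {t | t ∈ Icc 0 T ∧ ¬ p t} with hB
  have hbB : b ∈ B := ⟨hb, hpb⟩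
  have hbdd : BddBelow B := ⟨0, fun t ht => ht.1.1⟩
  have h0 : 0 ≤ sInf B := le_csInf ⟨b, hbB⟩ fun t ht => ht.1.1
  have hle : sInf B ≤ b := csInf_le hbdd hbB
  have hlt : ∀ u ∈ Ico 0 (sInf B), p u := by
    intro u hu
    by_contra hpu
    exact absurd (csInf_le hbdd ⟨⟨hu.1, hu.2.le.trans (hle.trans hb.2)⟩, hpu⟩) (not_le.2 hu.2)
  have hp := left _ ⟨h0, hle.trans hb.2⟩ hlt
  have hne : sInf B ≠ b := fun h => hpb (h ▸ hp)
  have hlt' : sInf B < b := lt_of_le_of_ne hle hne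
  obtain ⟨ε, hε, hr⟩ := right _ ⟨h0, hlt'.trans_le hb.2⟩ hp
  obtain ⟨u, hu, hu'⟩ := exists_lt_of_csInf_lt ⟨b, hbB⟩ (show sInf B < sInf B + ε by linarith)
  have := csInf_le hbdd hu
  rcases this.eq_or_lt with h | h
  · exact hu.2 (h ▸ hp)
  · exact hu.2 (hr u ⟨h, hu'⟩)

theorem lintegral_Icc_pow (L : ℝ≥0) (n : ℕ) {s : ℝ} (hs : 0 ≤ s) :
    L * ∫⁻ u in Icc 0 s, ENNReal.ofReal ((L * u) ^ n / n.factorial) =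
      ENNReal.ofReal ((L * s) ^ (n + 1) / (n + 1).factorial) := by
  rw [← ofReal_integral_eq_lintegral_ofReal]
  · rw [integral_Icc_eq_integral_Ioc, ← intervalIntegral.integral_of_le hs]
    have : ∀ u : ℝ, ((L : ℝ) * u) ^ n / n.factorial = (L : ℝ) ^ n / n.factorial * u ^ n := by
      intro u; rw [mul_pow]; ring
    simp_rw [this]
    rw [intervalIntegral.integral_const_mul, integral_pow, ← ENNReal.ofReal_coe_nnreal,
      ← ENNReal.ofReal_mul L.coe_nonneg]
    congr 1
    rw [Nat.factorial_succ]
    push_cast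
    field_simp
    ring
  · exact (Continuous.integrableOn_Icc (by fun_prop))
  · filter_upwards [ae_restrict_mem measurableSet_Icc] with u hu
    have := hu.1
    have := L.2
    positivity

/-- Iterating a Volterra inequality gains a factor `L s / (n + 1)` each time. -/
theorem volterra_iterate {d : ℕ → ℝ → ℝ≥0∞} {C : ℝ≥0∞} {L : ℝ≥0} (h0 : ∀ s, d 0 s ≤ C)
    (hd : ∀ n s, d (n + 1) s ≤ L * ∫⁻ u in Icc 0 s, d n u) (n : ℕ) {s : ℝ} (hs : 0 ≤ s) :
    d n s ≤ C * ENNReal.ofReal ((L * s) ^ n / n.factorial) := by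
  induction n generalizing s with
  | zero => simpa using h0 s
  | succ n ih =>
    calc d (n + 1) s ≤ L * ∫⁻ u in Icc 0 s, d n u := hd n s
      _ ≤ L * ∫⁻ u in Icc 0 s, C * ENNReal.ofReal ((L * u) ^ n / n.factorial) := by
        refine mul_le_mul_right ?_ _
        exact setLIntegral_mono' measurableSet_Icc fun u hu => ih hu.1
      _ = _ := by
        rw [lintegral_const_mul _ (by fun_prop), mul_left_comm, lintegral_Icc_pow L n hs]

/-- Grönwall's inequality in Volterra form: only the zero function satisfies it. -/
theorem eq_zero_of_volterra {d : ℝ → ℝ≥0∞} {C : ℝ≥0∞} {L : ℝ≥0} (hC : C ≠ ∞)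
    (h0 : ∀ s, d s ≤ C) (hd : ∀ s, d s ≤ L * ∫⁻ u in Icc 0 s, d u) {s : ℝ} (hs : 0 ≤ s) :
    d s = 0 := by
  have h := fun n => volterra_iterate (d := fun _ => d) h0 (fun _ => hd) n hs
  have hlim : Tendsto (fun n : ℕ => C * ENNReal.ofReal ((L * s) ^ n / n.factorial)) atTop
      (𝓝 (C * ENNReal.ofReal 0)) :=
    ENNReal.Tendsto.const_mul
      (ENNReal.tendsto_ofReal (FloorSemiring.tendsto_pow_div_factorial_atTop _)) (Or.inr hC)
  simpa using ge_of_tendsto' hlim h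

theorem tsum_volterra_ne_top {C : ℝ≥0∞} (hC : C ≠ ∞) (L : ℝ≥0) {s : ℝ} (hs : 0 ≤ s) :
    ∑' n : ℕ, C * ENNReal.ofReal ((L * s) ^ n / n.factorial) ≠ ∞ := by
  rw [ENNReal.tsum_mul_left]
  have hx : 0 ≤ (L : ℝ) * s := mul_nonneg L.2 hs
  rw [← ENNReal.ofReal_tsum_of_nonneg (fun n => by positivity)
    (Real.summable_pow_div_factorial _)]
  exact ENNReal.mul_ne_top hC ENNReal.ofReal_ne_top

/-! ### Poisson processes -/

section PoissonProcess

variable {Ω E F : Type*} [MeasurableSpace Ω] [MeasurableSpace E] [MeasurableSpace F]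
  {P : Measure Ω} {N : Ω → Measure E} {m : Measure E}

/-- Restrictions and images of Poisson processes are Poisson processes. -/
theorem IsPoissonProcess.map_restrict (h : IsPoissonProcess P N m) {W : Set E}
    (hW : MeasurableSet W) {f : E → F} (hf : Measurable f) :
    IsPoissonProcess P (fun ω => ((N ω).restrict W).map f) ((m.restrict W).map f) := by
  have key : ∀ (M : Measure E) {A : Set F}, MeasurableSet A →
      (M.restrict W).map f A = M (f ⁻¹' A ∩ W) := fun M A hA => by
    rw [Measure.map_apply hf hA, Measure.restrict_apply (hf hA)]
  have hm : ∀ {A : Set F}, MeasurableSet A → MeasurableSet (f ⁻¹' A ∩ W) :=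
    fun hA => (hf hA).inter hW
  refine ⟨?_, ?_, ?_, ?_⟩
  · refine Measure.measurable_of_measurable_coe _ fun A hA => ?_
    simp_rw [key _ hA]
    exact (Measure.measurable_coe (hm hA)).comp h.measurable
  · filter_upwards [h.counting] with ω hω A hA
    rw [key _ hA]
    exact hω _ (hm hA)
  · intro A hA hA'
    rw [key _ hA] at hA' ⊢
    simp_rw [key _ hA]
    exact h.law _ (hm hA) hA'
  · intro n A hA hd
    simp_rw [key _ (hA _)]
    refine h.indep n _ (fun i => hm (hA i)) fun i j hij => ?_
    exact ((hd hij).preimage f).mono inter_subset_left inter_subset_left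

theorem IsPoissonProcess.measurable_apply (h : IsPoissonProcess P N m) {A : Set E}
    (hA : MeasurableSet A) : Measurable fun ω => N ω A :=
  (Measure.measurable_coe hA).comp h.measurable

theorem IsPoissonProcess.measure_preimage (h : IsPoissonProcess P N m) {A : Set E}
    (hA : MeasurableSet A) (hmA : m A ≠ ∞) {B : Set ℝ≥0∞} (hB : MeasurableSet B) :
    P {ω | N ω A ∈ B} = poissonMeasure (m A).toNNReal {n : ℕ | (n : ℝ≥0∞) ∈ B} := by
  have := DFunLike.congr_fun (h.law A hA hmA) B
  rwa [Measure.map_apply (h.measurable_apply hA) hB,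
    Measure.map_apply (measurable_of_countable _) hB] at this

theorem IsPoissonProcess.ae_ne_top (h : IsPoissonProcess P N m) {A : Set E}
    (hA : MeasurableSet A) (hmA : m A ≠ ∞) : ∀ᵐ ω ∂P, N ω A ≠ ∞ := by
  have := h.measure_preimage hA hmA (measurableSet_singleton ∞)
  rw [ae_iff]
  simpa using this

theorem poissonMeasure_real_ne_zero_le (r : ℝ≥0) :
    (poissonMeasure r).real {n | n ≠ 0} ≤ r := by
  have h : {n : ℕ | n ≠ 0} = {0}ᶜ := by ext; simp
  rw [h, probReal_compl_eq_one_sub (measurableSet_singleton _), poissonMeasure_real_singleton]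
  have := Real.add_one_le_exp (-(r : ℝ))
  simp only [pow_zero, Nat.factorial_zero]
  norm_num
  linarith

theorem poissonMeasure_real_two_le_le (r : ℝ≥0) :
    (poissonMeasure r).real {n | 2 ≤ n} ≤ (r : ℝ) ^ 2 := by
  have h : {n : ℕ | 2 ≤ n} = ({0} ∪ {1})ᶜ := by ext; simp; omega
  rw [h, probReal_compl_eq_one_sub (by measurability),
    measureReal_union (by simp) (measurableSet_singleton _), poissonMeasure_real_singleton,
    poissonMeasure_real_singleton]
  have h1 := Real.add_one_le_exp (-(r : ℝ))
  have h2 : (0 : ℝ) ≤ r := r.2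
  simp only [pow_zero, Nat.factorial_zero, pow_one, Nat.factorial_one]
  norm_num
  nlinarith

theorem IsPoissonProcess.measure_ne_zero_le (h : IsPoissonProcess P N m) {A : Set E}
    (hA : MeasurableSet A) (hmA : m A ≠ ∞) : P {ω | N ω A ≠ 0} ≤ m A := by
  have h1 := h.measure_preimage hA hmA (measurableSet_singleton (0 : ℝ≥0∞)).compl
  have h2 := poissonMeasure_real_ne_zero_le (m A).toNNReal
  simp only [mem_compl_iff, mem_singleton_iff, Nat.cast_eq_zero] at h1
  change P {ω | ¬ N ω A = 0} ≤ m A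
  rw [h1, ← ofReal_measureReal]
  exact (ENNReal.ofReal_le_ofReal h2).trans_eq (ENNReal.ofReal_toReal hmA)

theorem IsPoissonProcess.measure_two_le_le (h : IsPoissonProcess P N m) {A : Set E}
    (hA : MeasurableSet A) (hmA : m A ≠ ∞) : P {ω | 2 ≤ N ω A} ≤ m A ^ 2 := by
  have h1 := h.measure_preimage hA hmA (measurableSet_Ici (a := (2 : ℝ≥0∞)))
  have h2 := poissonMeasure_real_two_le_le (m A).toNNReal
  have h3 : {n : ℕ | (n : ℝ≥0∞) ∈ Ici 2} = {n | 2 ≤ n} := by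
    ext n; simp only [mem_Ici, mem_ofPred_eq]; norm_cast
  change P {ω | N ω A ∈ Ici 2} ≤ m A ^ 2
  rw [h1, h3, ← ofReal_measureReal]
  refine (ENNReal.ofReal_le_ofReal h2).trans_eq ?_
  rw [ENNReal.ofReal_pow (NNReal.coe_nonneg _)]
  exact congrArg (· ^ 2) (ENNReal.ofReal_toReal hmA)

theorem IsPoissonProcess.ae_eq_zero (h : IsPoissonProcess P N m) {A : Set E}
    (hA : MeasurableSet A) (hmA : m A = 0) : ∀ᵐ ω ∂P, N ω A = 0 := by
  have := h.measure_ne_zero_le hA (by simp [hmA])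
  rw [hmA] at this
  exact nonpos_iff_eq_zero.1 this

/-- The points that belong to exactly those members `A i` of a family for which `σ i` is true. -/
def cell {n : ℕ} (A : Fin n → Set E) (σ : Fin n → Bool) : Set E :=
  {x | ∀ i, x ∈ A i ↔ σ i = true}

theorem measurableSet_cell {n : ℕ} {A : Fin n → Set E} (hA : ∀ i, MeasurableSet (A i))
    (σ : Fin n → Bool) : MeasurableSet (cell A σ) := by
  have : cell A σ = ⋂ i, {x | x ∈ A i ↔ σ i = true} := by ext; simp [cell]
  rw [this]
  refine MeasurableSet.iInter fun i => ?_
  cases h : σ i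
  · simp only [Bool.false_eq_true, iff_false]
    exact (hA i).compl
  · simp only [iff_true]
    exact hA i

theorem disjoint_cell {X : Type*} {n : ℕ} {A : Fin n → Set X} {σ τ : Fin n → Bool} (h : σ ≠ τ) :
    Disjoint (cell A σ) (cell A τ) := by
  rw [Set.disjoint_left]
  intro x hx hx'
  apply h
  ext i
  rw [Bool.eq_iff_iff, ← hx i, hx' i]

theorem measure_eq_sum_cell {n : ℕ} {A : Fin n → Set E} (hA : ∀ i, MeasurableSet (A i))
    (M : Measure E) (i : Fin n) :
    M (A i) = ∑ σ : Fin n → Bool, if σ i then M (cell A σ) else 0 := by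
  have : A i = ⋃ σ ∈ Finset.univ.filter (fun σ : Fin n → Bool => σ i = true), cell A σ := by
    ext x
    simp only [Finset.mem_filter, Finset.mem_univ, true_and, mem_iUnion, exists_prop]
    constructor
    · intro hx
      classical
      exact ⟨fun j => decide (x ∈ A j), by simpa using hx, fun j => by simp⟩
    · rintro ⟨σ, hσ, hx⟩
      exact (hx i).2 hσ
  conv_lhs => rw [this]
  rw [measure_biUnion_finset (fun σ _ τ _ h => disjoint_cell h)
    (fun σ _ => measurableSet_cell hA σ), Finset.sum_filter]

/-- The cells of a family of sets are disjoint, so their numbers of points are independent Poisson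
variables. -/
theorem IsPoissonProcess.map_cells (h : IsPoissonProcess P N m) [IsProbabilityMeasure P]
    [IsFiniteMeasure m] {n : ℕ} {A : Fin n → Set E} (hA : ∀ i, MeasurableSet (A i)) :
    P.map (fun ω σ => N ω (cell A σ)) =
      Measure.pi fun σ =>
        (poissonMeasure (m (cell A σ)).toNNReal).map (fun n : ℕ => (n : ℝ≥0∞)) := by
  have hind : iIndepFun (fun σ ω => N ω (cell A σ)) P := by
    let e := Fintype.equivFin (Fin n → Bool)
    have := h.indep _ (fun i => cell A (e.symm i)) (fun i => measurableSet_cell hA _)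
      (fun i j hij => disjoint_cell (e.symm.injective.ne hij))
    have h2 := this.precomp e.injective
    simpa [Function.comp_def] using h2
  rw [(iIndepFun_iff_map_fun_eq_pi_map
    (fun σ => (h.measurable_apply (measurableSet_cell hA σ)).aemeasurable)).1 hind]
  congr 1
  ext1 σ
  exact h.law _ (measurableSet_cell hA σ) (measure_ne_top _ _)

/-- The joint law of the numbers of points in arbitrary sets is the image of the one for the cells. -/
theorem IsPoissonProcess.map_family (h : IsPoissonProcess P N m) {n : ℕ} {A : Fin n → Set E}
    (hA : ∀ i, MeasurableSet (A i)) :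
    P.map (fun ω i => N ω (A i)) = (P.map (fun ω σ => N ω (cell A σ))).map
      (fun (x : (Fin n → Bool) → ℝ≥0∞) i => ∑ σ : Fin n → Bool, if σ i then x σ else 0) := by
  have hg : Measurable fun (x : (Fin n → Bool) → ℝ≥0∞) (i : Fin n) =>
      ∑ σ : Fin n → Bool, if σ i then x σ else 0 := by
    refine measurable_pi_lambda _ fun i => Finset.measurable_sum _ fun σ _ => ?_
    split_ifs <;> fun_prop
  rw [Measure.map_map hg
    (measurable_pi_lambda _ fun σ => h.measurable_apply (measurableSet_cell hA σ))]
  congr 1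
  ext ω i
  exact measure_eq_sum_cell hA (N ω) i

/-- The law of a Poisson process with finite intensity is determined by the intensity: the
`σ`-algebra on measures is generated by the evaluations, whose finite-dimensional laws are known. -/
theorem IsPoissonProcess.map_eq {Ω' : Type*} [MeasurableSpace Ω'] {P' : Measure Ω'}
    {N' : Ω' → Measure E} [IsProbabilityMeasure P] [IsProbabilityMeasure P'] [IsFiniteMeasure m]
    (h : IsPoissonProcess P N m) (h' : IsPoissonProcess P' N' m) : P.map N = P'.map N' := by
  have hfin : ∀ (n : ℕ) (A : Fin n → Set E), (∀ i, MeasurableSet (A i)) →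
      P.map (fun ω i => N ω (A i)) = P'.map (fun ω i => N' ω (A i)) := by
    intro n A hA
    rw [h.map_family hA, h'.map_family hA, h.map_cells hA, h'.map_cells hA]
  let φ : Measure E → {A : Set E // MeasurableSet A} → ℝ≥0∞ := fun M A => M A
  have hφ : Measurable φ := measurable_pi_lambda _ fun A => Measure.measurable_coe A.2
  have hcomap : (Measure.instMeasurableSpace : MeasurableSpace (Measure E)) ≤
      MeasurableSpace.comap φ inferInstance := by
    refine iSup₂_le fun A hA => ?_
    have : (fun M : Measure E => M A) =
        (fun x : {A : Set E // MeasurableSet A} → ℝ≥0∞ => x ⟨A, hA⟩) ∘ φ := rfl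
    rw [this, ← MeasurableSpace.comap_comp]
    exact MeasurableSpace.comap_mono (measurable_pi_apply _).comap_le
  have hproj : (P.map N).map φ = (P'.map N').map φ := by
    have : IsProbabilityMeasure (P.map N) :=
      Measure.isProbabilityMeasure_map h.measurable.aemeasurable
    have : IsProbabilityMeasure (P'.map N') :=
      Measure.isProbabilityMeasure_map h'.measurable.aemeasurable
    have := fun I : Finset {A : Set E // MeasurableSet A} => Measure.isProbabilityMeasure_map
      (μ := P'.map N') (f := fun M => I.restrict (φ M)) (by fun_prop)
    refine IsProjectiveLimit.unique (P := fun I => (P'.map N').map (fun M => I.restrict (φ M))) ?_ ?_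
    · intro I
      rw [Measure.map_map (by fun_prop) hφ, Measure.map_map (by fun_prop) h.measurable]
      change _ = (P'.map N').map (fun M => I.restrict (φ M))
      rw [Measure.map_map (by fun_prop) h'.measurable]
      let e := I.equivFin
      have := hfin I.card (fun i => (e.symm i).1.1) (fun i => (e.symm i).1.2)
      have hg : Measurable fun (x : Fin I.card → ℝ≥0∞) (A : I) => x (e A) := by fun_prop
      have := congrArg (Measure.map fun (x : Fin I.card → ℝ≥0∞) (A : I) => x (e A)) this
      rw [Measure.map_map hg (measurable_pi_lambda _ fun i => h.measurable_apply (e.symm i).1.2),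
        Measure.map_map hg (measurable_pi_lambda _ fun i => h'.measurable_apply (e.symm i).1.2)] at this
      simpa [Function.comp_def, φ, Finset.restrict_def] using this
    · intro I
      rw [Measure.map_map (by fun_prop) hφ]
      rfl
  ext B hB
  obtain ⟨B', hB', rfl⟩ := hcomap B hB
  rw [← Measure.map_apply hφ hB', hproj, Measure.map_apply hφ hB']

end PoissonProcess

/-! ### Paths driven by finitely many points -/

section Paths

theorem before_eq {f : ℝ → State} {s : ℝ} {q : State} (hs : 0 < s)
    (h : ∀ᶠ u in 𝓝[<] s, f u = q) : before f s = q := by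
  rw [before, if_pos hs]
  exact leftLim_eq_of_tendsto (tendsto_const_nhds.congr' (h.mono fun u hu => hu.symm))

theorem before_zero (f : ℝ → State) : before f 0 = f 0 := if_neg (lt_irrefl _)

theorem IsCadlagOn.eventually_eq_before {T : ℝ} {f : ℝ → State} (hf : IsCadlagOn T f) {s : ℝ}
    (hs : s ∈ Ioc 0 T) : ∀ᶠ u in 𝓝[<] s, f u = before f s := by
  obtain ⟨q, hq⟩ := hf.2 s hs
  have h : ∀ᶠ u in 𝓝[<] s, f u = q := by simpa [nhds_discrete] using hq
  rwa [before_eq hs.1 h]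

theorem IsCadlagOn.eventually_eq_right {T : ℝ} {f : ℝ → State} (hf : IsCadlagOn T f) {t : ℝ}
    (ht : t ∈ Ico 0 T) : ∃ ε > 0, ∀ u ∈ Ioo t (t + ε), f u = f t := by
  have h : ∀ᶠ u in 𝓝[≥] t, f u = f t := by
    simpa [ContinuousWithinAt, nhds_discrete] using hf.1 t ht
  obtain ⟨b, hb, hb'⟩ := (mem_nhdsGE_iff_exists_Ico_subset).1 h
  exact ⟨b - t, sub_pos.2 hb, fun u hu => hb' ⟨hu.1.le, by linarith [hu.2]⟩⟩

theorem IsCadlagOn.mono {S T : ℝ} {f : ℝ → State} (hf : IsCadlagOn T f) (h : S ≤ T) :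
    IsCadlagOn S f :=
  ⟨fun t ht => hf.1 t ⟨ht.1, ht.2.trans_le h⟩, fun t ht => hf.2 t ⟨ht.1, ht.2.trans h⟩⟩

theorem before_congr {T : ℝ} {f g : ℝ → State} (hf : IsCadlagOn T f) {s : ℝ} (hs : s ∈ Icc 0 T)
    (h : ∀ u ∈ Ico 0 s, f u = g u) (h0 : f 0 = g 0) : before f s = before g s := by
  rcases hs.1.eq_or_lt with rfl | h'
  · rw [before_zero, before_zero, h0]
  · refine (before_eq h' ?_).symm
    filter_upwards [hf.eventually_eq_before ⟨h', hs.2⟩, Ioo_mem_nhdsLT h'] with u hu hu'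
    rw [← h u ⟨hu'.1.le, hu'.2⟩, hu]

theorem before_mem_chi {K : ℕ} {T : ℝ} {f : ℝ → State} (hf : IsCadlagOn T f)
    (hchi : ∀ t ∈ Icc 0 T, f t ∈ chi K) {s : ℝ} (hs : s ∈ Icc 0 T) : before f s ∈ chi K := by
  rcases hs.1.eq_or_lt with rfl | h'
  · rw [before_zero]; exact hchi 0 hs
  · obtain ⟨u, hu, hu'⟩ := ((hf.eventually_eq_before ⟨h', hs.2⟩).and (Ioo_mem_nhdsLT h')).exists
    rw [← hu]
    exact hchi u ⟨hu'.1.le, hu'.2.le.trans hs.2⟩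

end Paths

/-- The points `(s, h)` with `s ∈ I` that lie below the graph of `c`. -/
def hits (c : ℝ → ℝ) (I : Set ℝ) : Set (ℝ × ℝ) := {p | p.1 ∈ I ∧ 0 ≤ p.2 ∧ p.2 ≤ c p.1}

theorem measurableSet_hits_singleton (c : ℝ → ℝ) (t : ℝ) : MeasurableSet (hits c {t}) := by
  have : hits c {t} = {t} ×ˢ Icc 0 (c t) := by
    ext ⟨a, b⟩
    simp only [hits, mem_ofPred_eq, mem_singleton_iff, mem_prod, mem_Icc]
    exact and_congr_right fun h => by rw [h]
  rw [this]
  exact (measurableSet_singleton t).prod measurableSet_Icc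

/-- A jump mechanism on `State`: at a point `(s, h)` of the `i`-th driving measure, the process
jumps from `q'` to `q' + jump i` if `h ≤ rate i s q'`. It starts from `init`, and is meant to stay
in `chi K`. -/
structure Dynamics (ι : Type*) where
  rate : ι → ℝ → State → ℝ
  jump : ι → Fin 4 → ℝ
  K : ℕ
  init : State

/-- Jumps of positive rate do not leave the state space. -/
structure Dynamics.Admissible {ι : Type*} (A : Dynamics ι) : Prop where
  init_mem : A.init ∈ chi A.K
  jump_mem : ∀ i s, ∀ q ∈ chi A.K, 0 < A.rate i s q →
    ∃ q' ∈ chi A.K, ∀ k, (q' k : ℝ) = q k + A.jump i k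

/-- The measures `M i` consist of finitely many points `(s, h)`, with `s ≠ 0` and `h ≠ 0`, and
no two of all these points have the same time `s`. -/
structure IsSimple {ι : Type*} [Fintype ι] (M : ι → Measure (ℝ × ℝ)) : Prop where
  finite : ∀ i, IsFiniteMeasure (M i)
  counting : ∀ i A, MeasurableSet A → ∃ n : ℕ, M i A = n
  time_zero : ∀ i, M i (Prod.fst ⁻¹' {0}) = 0
  height_zero : ∀ i, M i (Prod.snd ⁻¹' {0}) = 0
  simple : ∀ s, ∑ i, M i (Prod.fst ⁻¹' {s}) ≤ 1

/-- A retraction of `ℝ⁴` onto `chi K`. Only the values at vectors that are states matter; elsewhere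
it serves to keep the Picard iterates, and the path itself, in the state space. -/
def clip (K : ℕ) (x : Fin 4 → ℝ) : State :=
  if total (fun k => ⌊x k⌋₊) ≤ K then fun k => ⌊x k⌋₊ else 0

theorem clip_mem_chi (K : ℕ) (x : Fin 4 → ℝ) : clip K x ∈ chi K := by
  unfold clip
  split_ifs with h
  · exact h
  · simp [chi, total]

theorem clip_cast {K : ℕ} {q : State} (hq : q ∈ chi K) : clip K (fun k => (q k : ℝ)) = q := by
  have : (fun k => ⌊(q k : ℝ)⌋₊) = q := by ext k; simp
  rw [clip, this]
  exact if_pos hq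

variable {ι : Type*} [Fintype ι] (A : Dynamics ι) (M : ι → Measure (ℝ × ℝ))

/-- The state reached from the initial one by the jumps at times in `I`, if the path before these
jumps is `y`; a vector of real numbers, which need not be a state for arbitrary `y`. -/
def Dynamics.reached (y : ℝ → State) (I : Set ℝ) : Fin 4 → ℝ := fun k =>
  A.init k + ∑ i, A.jump i k * (M i (hits (fun s => A.rate i s (y s)) I)).toReal

/-- Picard iterates for the path of left limits: the interval `[0, s)` is open at `s`, so that the
iterates are left limits themselves. -/
def Dynamics.picard : ℕ → ℝ → State
  | 0, _ => A.init
  | m + 1, s => clip A.K (A.reached M (Dynamics.picard m) (Ico 0 s))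

/-- The path of left limits of the solution: the Picard iterates are constant as soon as
their number exceeds the number of points. -/
def Dynamics.leftPath (s : ℝ) : State :=
  A.picard M (⌈(∑ i, M i univ).toReal⌉₊ + 1) s

/-- The path driven by the measures `M`. -/
def Dynamics.path (t : ℝ) : State := clip A.K (A.reached M (A.leftPath M) (Icc 0 t))

/-- The times of all points of the driving measures. -/
def times : Measure ℝ := ∑ i, (M i).map Prod.fst

theorem times_apply {B : Set ℝ} (hB : MeasurableSet B) :
    times M B = ∑ i, M i (Prod.fst ⁻¹' B) := by
  simp [times, Measure.map_apply measurable_fst hB]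

variable {A M}

theorem preimage_fst_null {B : Set ℝ} (hB : times M B = 0) (i : ι) :
    M i (Prod.fst ⁻¹' B) = 0 := by
  refine Measure.preimage_null_of_map_null measurable_fst.aemeasurable ?_
  simp only [times, Measure.coe_finsetSum, Finset.sum_apply, Finset.sum_eq_zero_iff] at hB
  exact hB i (Finset.mem_univ i)

theorem IsSimple.isFiniteMeasure_times (hM : IsSimple M) : IsFiniteMeasure (times M) := by
  have := hM.finite
  refine ⟨?_⟩
  rw [times_apply M .univ]
  exact ENNReal.sum_lt_top.2 fun i _ => measure_lt_top _ _

theorem IsSimple.times_counting (hM : IsSimple M) {B : Set ℝ} (hB : MeasurableSet B) :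
    ∃ n : ℕ, times M B = n := by
  rw [times_apply M hB]
  choose n hn using fun i => hM.counting i _ (measurable_fst hB)
  exact ⟨∑ i, n i, by simp [hn]⟩

theorem IsSimple.times_eq_zero (hM : IsSimple M) {B : Set ℝ} (hB : MeasurableSet B)
    (h : times M B < 1) : times M B = 0 := by
  obtain ⟨n, hn⟩ := hM.times_counting hB
  rw [hn] at h ⊢
  have : n < 1 := by exact_mod_cast h
  simp [Nat.lt_one_iff.1 this]

theorem IsSimple.times_zero (hM : IsSimple M) : times M {0} = 0 := by
  simp [times_apply M (measurableSet_singleton 0), hM.time_zero]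

theorem IsSimple.exists_times_Ioc (hM : IsSimple M) (t : ℝ) :
    ∃ ε > 0, times M (Ioc t (t + ε)) = 0 := by
  have := hM.isFiniteMeasure_times
  have hlim : Tendsto (fun n : ℕ => times M (Ioc t (t + 1 / ((n : ℝ) + 1)))) atTop
      (𝓝 (times M (⋂ n : ℕ, Ioc t (t + 1 / ((n : ℝ) + 1))))) := by
    refine tendsto_measure_iInter_atTop (fun n => measurableSet_Ioc.nullMeasurableSet) ?_
      ⟨0, measure_ne_top _ _⟩
    intro m n hmn
    exact Ioc_subset_Ioc_right (by gcongr)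
  have h0 : (⋂ n : ℕ, Ioc t (t + 1 / ((n : ℝ) + 1))) = ∅ := by
    ext x
    simp only [mem_iInter, mem_empty_iff_false, iff_false, not_forall]
    by_cases hx : t < x
    · obtain ⟨n, hn⟩ := exists_nat_one_div_lt (sub_pos.2 hx)
      exact ⟨n, fun h => by linarith [h.2]⟩
    · exact ⟨0, fun h => hx h.1⟩
  rw [h0, measure_empty] at hlim
  obtain ⟨n, hn⟩ := (hlim.eventually (gt_mem_nhds one_pos)).exists
  exact ⟨_, Nat.one_div_pos_of_nat, hM.times_eq_zero measurableSet_Ioc hn⟩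

theorem IsSimple.exists_times_Ioo (hM : IsSimple M) (t : ℝ) :
    ∃ ε > 0, times M (Ioo (t - ε) t) = 0 := by
  have := hM.isFiniteMeasure_times
  have hlim : Tendsto (fun n : ℕ => times M (Ioo (t - 1 / ((n : ℝ) + 1)) t)) atTop
      (𝓝 (times M (⋂ n : ℕ, Ioo (t - 1 / ((n : ℝ) + 1)) t))) := by
    refine tendsto_measure_iInter_atTop (fun n => measurableSet_Ioo.nullMeasurableSet) ?_
      ⟨0, measure_ne_top _ _⟩
    intro m n hmn
    exact Ioo_subset_Ioo_left (by gcongr)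
  have h0 : (⋂ n : ℕ, Ioo (t - 1 / ((n : ℝ) + 1)) t) = ∅ := by
    ext x
    simp only [mem_iInter, mem_empty_iff_false, iff_false, not_forall]
    by_cases hx : x < t
    · obtain ⟨n, hn⟩ := exists_nat_one_div_lt (sub_pos.2 hx)
      exact ⟨n, fun h => by linarith [h.1]⟩
    · exact ⟨0, fun h => hx h.2⟩
  rw [h0, measure_empty] at hlim
  obtain ⟨n, hn⟩ := (hlim.eventually (gt_mem_nhds one_pos)).exists
  exact ⟨_, Nat.one_div_pos_of_nat, hM.times_eq_zero measurableSet_Ioo hn⟩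

/-- Times that are not charged by the driving measures do not matter. -/
theorem measure_hits_congr {i : ι} {c c' : ℝ → ℝ} {I J B : Set ℝ} (hB : times M B = 0)
    (hIJ : ∀ u ∉ B, (u ∈ I ↔ u ∈ J)) (hc : ∀ u ∉ B, u ∈ I → c u = c' u) :
    M i (hits c I) = M i (hits c' J) := by
  have hB' := preimage_fst_null hB i
  apply le_antisymm
  · refine (measure_mono (t := hits c' J ∪ Prod.fst ⁻¹' B) fun p hp => ?_).trans
      ((measure_union_le _ _).trans (by rw [hB', add_zero]))
    by_cases h : p.1 ∈ B
    · exact Or.inr h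
    · exact Or.inl ⟨(hIJ _ h).1 hp.1, hp.2.1, hc _ h hp.1 ▸ hp.2.2⟩
  · refine (measure_mono (t := hits c I ∪ Prod.fst ⁻¹' B) fun p hp => ?_).trans
      ((measure_union_le _ _).trans (by rw [hB', add_zero]))
    by_cases h : p.1 ∈ B
    · exact Or.inr h
    · have hI := (hIJ _ h).2 hp.1
      exact Or.inl ⟨hI, hp.2.1, (hc _ h hI).symm ▸ hp.2.2⟩

theorem reached_congr {y y' : ℝ → State} {I J B : Set ℝ} (hB : times M B = 0)
    (hIJ : ∀ u ∉ B, (u ∈ I ↔ u ∈ J)) (hy : ∀ u ∉ B, u ∈ I → y u = y' u) :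
    A.reached M y I = A.reached M y' J := by
  ext k
  simp only [Dynamics.reached]
  congr 1
  refine Finset.sum_congr rfl fun i _ => ?_
  rw [measure_hits_congr hB hIJ fun u hu hI => by rw [hy u hu hI]]

theorem reached_eq_init {y : ℝ → State} {I : Set ℝ} (hI : times M I = 0) :
    A.reached M y I = fun k => (A.init k : ℝ) := by
  rw [reached_congr (J := ∅) (y' := y) hI (fun u hu => by simp [hu]) (fun _ _ _ => rfl)]
  ext k
  simp [Dynamics.reached, hits]

/-- A finite measure does not charge the times in `[0, s)` before which it has already used up
its mass on `[0, s)`. -/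
theorem measure_late_eq_zero (μ : Measure ℝ) [IsFiniteMeasure μ] {s : ℝ} {k : ℝ≥0∞}
    (hk : μ (Ico 0 s) ≤ k) : μ {u | u ∈ Ico 0 s ∧ k ≤ μ (Ico 0 u)} = 0 := by
  set B : Set ℝ := {u | u ∈ Ico 0 s ∧ k ≤ μ (Ico 0 u)} with hB
  have hnull : ∀ u ∈ B, μ (Ico u s) = 0 := by
    rintro u ⟨hu, hku⟩
    have h : μ (Ico 0 u) + μ (Ico u s) = μ (Ico 0 s) := by
      rw [← measure_union _ measurableSet_Ico, Ico_union_Ico_eq_Ico hu.1 hu.2.le]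
      rw [Set.disjoint_left]
      exact fun x hx hx' => absurd hx.2 (not_lt.2 hx'.1)
    have hle : μ (Ico 0 u) + μ (Ico u s) ≤ μ (Ico 0 u) + 0 := by
      rw [h, add_zero]; exact hk.trans hku
    exact nonpos_iff_eq_zero.1
      ((ENNReal.add_le_add_iff_left (measure_ne_top _ _)).1 hle)
  rcases B.eq_empty_or_nonempty with h | h
  · rw [h, measure_empty]
  have hbdd : BddBelow B := ⟨0, fun u hu => hu.1.1⟩
  by_cases hmem : sInf B ∈ B
  · exact measure_mono_null (fun u hu => mem_Ico.2 ⟨csInf_le hbdd hu, hu.1.2⟩) (hnull _ hmem)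
  · obtain ⟨u, -, hlim, hu⟩ := exists_seq_tendsto_sInf h hbdd
    refine measure_mono_null (t := ⋃ n, Ico (u n) s) (fun x hx => ?_)
      (measure_iUnion_null fun n => hnull _ (hu n))
    have hlt : sInf B < x := lt_of_le_of_ne (csInf_le hbdd hx) fun h => hmem (h ▸ hx)
    obtain ⟨n, hn⟩ := (hlim.eventually (gt_mem_nhds hlt)).exists
    exact mem_iUnion.2 ⟨n, mem_Ico.2 ⟨hn.le, hx.1.2⟩⟩

/-- Up to the `k`-th point, the Picard iteration is stationary after `k + 1` steps. -/
theorem IsSimple.picard_succ_eq (hM : IsSimple M) (k : ℕ) :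
    ∀ s, times M (Ico 0 s) ≤ k → ∀ m, k + 1 ≤ m → A.picard M m s = A.picard M (m + 1) s := by
  have := hM.isFiniteMeasure_times
  induction k with
  | zero =>
    intro s hs m hm
    obtain ⟨m, rfl⟩ := Nat.exists_eq_add_of_le' hm
    have h0 : times M (Ico 0 s) = 0 := by simpa using hs
    simp only [Dynamics.picard, reached_eq_init h0]
  | succ k ih =>
    intro s hs m hm
    obtain ⟨m, rfl⟩ := Nat.exists_eq_add_of_le' (by omega : 1 ≤ m)
    rw [Dynamics.picard, Dynamics.picard]
    congr 1
    refine reached_congr (measure_late_eq_zero (times M) hs) (fun _ _ => Iff.rfl) ?_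
    intro u hu hus
    obtain ⟨n, hn⟩ := hM.times_counting (measurableSet_Ico (a := (0 : ℝ)) (b := u))
    refine ih u ?_ m (by omega)
    have : ¬ ((k + 1 : ℕ) : ℝ≥0∞) ≤ times M (Ico 0 u) := fun h => hu ⟨hus, h⟩
    rw [hn] at this ⊢
    have : n ≤ k := by
      by_contra h
      exact this (by exact_mod_cast (by omega : k + 1 ≤ n))
    exact_mod_cast this

/-- The path of left limits is a fixed point of the Picard iteration. -/
theorem IsSimple.leftPath_eq (hM : IsSimple M) (s : ℝ) :
    A.leftPath M s = clip A.K (A.reached M (A.leftPath M) (Ico 0 s)) := by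
  have := hM.isFiniteMeasure_times
  have htot : times M univ = ∑ i, M i univ := by simp [times_apply M .univ]
  have hle : times M (Ico 0 s) ≤ (⌈(∑ i, M i univ).toReal⌉₊ : ℝ≥0∞) := by
    refine (measure_mono (subset_univ _)).trans ?_
    rw [← htot, ← ENNReal.ofReal_toReal (measure_ne_top (times M) univ), ← ENNReal.ofReal_natCast,
      ENNReal.toReal_ofReal ENNReal.toReal_nonneg]
    exact ENNReal.ofReal_le_ofReal (Nat.le_ceil _)
  exact hM.picard_succ_eq _ s hle _ le_rfl

theorem clip_reached {y : ℝ → State} {I : Set ℝ}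
    (h : ∃ q ∈ chi A.K, ∀ k, A.reached M y I k = q k) (k : Fin 4) :
    (clip A.K (A.reached M y I) k : ℝ) = A.reached M y I k := by
  obtain ⟨q, hq, hk⟩ := h
  rw [funext hk, clip_cast hq]

theorem reached_Icc (y : ℝ → State) {t : ℝ} (ht : 0 ≤ t) (hM : ∀ i, IsFiniteMeasure (M i))
    (k : Fin 4) :
    A.reached M y (Icc 0 t) k = A.reached M y (Ico 0 t) k +
      ∑ i, A.jump i k * (M i (hits (fun s => A.rate i s (y s)) {t})).toReal := by
  simp only [Dynamics.reached]
  rw [add_assoc, ← Finset.sum_add_distrib]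
  congr 1
  refine Finset.sum_congr rfl fun i _ => ?_
  rw [← mul_add, ← ENNReal.toReal_add (measure_ne_top _ _) (measure_ne_top _ _), ← measure_union]
  · congr 3
    ext p
    simp only [hits, mem_ofPred_eq, mem_union, mem_singleton_iff, mem_Icc, mem_Ico]
    rw [← or_and_right]
    refine and_congr_left fun _ => ?_
    constructor
    · rintro ⟨h1, h2⟩
      exact h2.lt_or_eq.imp (fun h => ⟨h1, h⟩) id
    · rintro (h | h)
      · exact ⟨h.1, h.2.le⟩
      · exact ⟨h ▸ ht, h.le⟩
  · rw [Set.disjoint_left]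
    rintro p ⟨hp, -⟩ ⟨hp', -⟩
    exact hp.2.ne hp'
  · exact measurableSet_hits_singleton _ t

/-- At most one point of positive height is present at time `t`, and the corresponding jump
is admissible. -/
theorem IsSimple.jump_mem (hM : IsSimple M) (hA : A.Admissible) (y : ℝ → State) {t : ℝ}
    (hy : y t ∈ chi A.K) : ∃ q ∈ chi A.K, ∀ k, (q k : ℝ) = y t k +
      ∑ i, A.jump i k * (M i (hits (fun s => A.rate i s (y s)) {t})).toReal := by
  set H : ι → Set (ℝ × ℝ) := fun i => hits (fun s => A.rate i s (y s)) {t} with hH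
  have hsub : ∀ i, H i ⊆ Prod.fst ⁻¹' {t} := fun i p hp => hp.1
  by_cases h : ∀ i, M i (H i) = 0
  · refine ⟨y t, hy, fun k => ?_⟩
    simp [show ∀ i, M i (hits (fun s => A.rate i s (y s)) {t}) = 0 from h]
  push Not at h
  obtain ⟨i, hi⟩ := h
  have hmeas : MeasurableSet (H i) := measurableSet_hits_singleton _ t
  have hone : M i (H i) = 1 ∧ ∀ j, j ≠ i → M j (H j) = 0 := by
    classical
    have hs := hM.simple t
    have hle : ∑ j, M j (H j) ≤ 1 :=
      (Finset.sum_le_sum fun j _ => measure_mono (hsub j)).trans hs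
    rw [← Finset.add_sum_erase _ _ (Finset.mem_univ i)] at hle
    obtain ⟨n, hn⟩ := hM.counting i _ hmeas
    have hn1 : 1 ≤ M i (H i) := by
      rw [hn] at hi ⊢
      exact_mod_cast Nat.one_le_iff_ne_zero.2 (by exact_mod_cast hi)
    have heq : M i (H i) = 1 := le_antisymm ((le_add_right le_rfl).trans hle) hn1
    refine ⟨heq, fun j hj => ?_⟩
    rw [heq] at hle
    have h0 : ∑ x ∈ Finset.univ.erase i, M x (H x) ≤ 0 :=
      (ENNReal.add_le_add_iff_left (a := 1) ENNReal.one_ne_top).1 (by simpa using hle)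
    exact Finset.sum_eq_zero_iff.1 (nonpos_iff_eq_zero.1 h0) j
      (Finset.mem_erase.2 ⟨hj, Finset.mem_univ j⟩)
  have hpos : 0 < A.rate i t (y t) := by
    by_contra hle
    refine hi (measure_mono_null (fun p hp => ?_) (hM.height_zero i))
    have h1 : p.1 = t := hp.1
    have h2 := hp.2.2
    simp only [h1] at h2
    exact le_antisymm (h2.trans (not_lt.1 hle)) hp.2.1
  obtain ⟨q, hq, hk⟩ := hA.jump_mem i t _ hy hpos
  refine ⟨q, hq, fun k => ?_⟩
  rw [hk k, Finset.sum_eq_single i (fun j _ hj => ?_) (by simp), hone.1]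
  · simp
  · rw [show M j (hits (fun s => A.rate j s (y s)) {t}) = 0 from hone.2 j hj]
    simp

theorem IsSimple.reached_Ico (hM : IsSimple M) {y : ℝ → State} {s : ℝ} (hs : 0 < s) :
    ∀ᶠ u in 𝓝[<] s, A.reached M y (Icc 0 u) = A.reached M y (Ico 0 s) := by
  obtain ⟨ε, hε, h0⟩ := hM.exists_times_Ioo s
  filter_upwards [Ioo_mem_nhdsLT hs, Ioo_mem_nhdsLT (show s - ε < s by linarith)] with u hu hu'
  refine reached_congr h0 (fun x hx => ?_) (fun _ _ _ => rfl)
  simp only [mem_Icc, mem_Ico]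
  refine and_congr_right fun _ => ⟨fun h => h.trans_lt hu.2, fun h => ?_⟩
  by_contra hxu
  exact hx ⟨hu'.1.trans (not_le.1 hxu), h⟩

theorem IsSimple.reached_Icc_right (hM : IsSimple M) (y : ℝ → State) (t : ℝ) :
    ∃ ε > 0, ∀ u ∈ Ico t (t + ε), A.reached M y (Icc 0 u) = A.reached M y (Icc 0 t) := by
  obtain ⟨ε, hε, h0⟩ := hM.exists_times_Ioc t
  refine ⟨ε, hε, fun u hu => (reached_congr h0 (fun x hx => ?_) (fun _ _ _ => rfl)).symm⟩
  simp only [mem_Icc]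
  refine and_congr_right fun _ => ⟨fun h => h.trans hu.1, fun h => ?_⟩
  by_contra hxu
  exact hx ⟨not_le.1 hxu, h.trans hu.2.le⟩

/-- The jumps lead from states to states, so `clip` has no effect along the path. -/
theorem IsSimple.reached_mem (hM : IsSimple M) (hA : A.Admissible) {t : ℝ} (ht : 0 ≤ t) :
    ∃ q ∈ chi A.K, ∀ k, A.reached M (A.leftPath M) (Icc 0 t) k = q k := by
  refine forall_mem_Icc_of_step
    (p := fun t => ∃ q ∈ chi A.K, ∀ k, A.reached M (A.leftPath M) (Icc 0 t) k = q k)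
    (T := t) ?_ ?_ t ⟨ht, le_rfl⟩
  · intro s hs ih
    have hIco : ∃ q ∈ chi A.K, ∀ k, A.reached M (A.leftPath M) (Ico 0 s) k = q k := by
      rcases hs.1.eq_or_lt with rfl | hpos
      · refine ⟨A.init, hA.init_mem, fun k => ?_⟩
        rw [reached_eq_init (by simp)]
      · obtain ⟨u, hu, hu'⟩ :=
          ((hM.reached_Ico (A := A) (y := A.leftPath M) hpos).and (Ioo_mem_nhdsLT hpos)).exists
        rw [← hu]
        exact ih u ⟨hu'.1.le, hu'.2⟩
    have hcl := clip_reached hIco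
    rw [← hM.leftPath_eq] at hcl
    obtain ⟨q, hq, hk⟩ := hM.jump_mem hA (A.leftPath M) (t := s)
      (by rw [hM.leftPath_eq]; exact clip_mem_chi _ _)
    refine ⟨q, hq, fun k => ?_⟩
    rw [reached_Icc _ hs.1 hM.finite, hk k, hcl k]
  · intro s hs h
    obtain ⟨ε, hε, hr⟩ := hM.reached_Icc_right (A := A) (A.leftPath M) s
    refine ⟨ε, hε, fun u hu => ?_⟩
    rw [hr u ⟨hu.1.le, hu.2⟩]
    exact h

theorem IsSimple.path_cadlag (hM : IsSimple M) (T : ℝ) : IsCadlagOn T (A.path M) := by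
  constructor
  · intro t ht
    obtain ⟨ε, hε, hr⟩ := hM.reached_Icc_right (A := A) (A.leftPath M) t
    refine tendsto_const_nhds.congr' ?_
    filter_upwards [Ico_mem_nhdsGE (show t < t + ε by linarith)] with u hu
    rw [Dynamics.path, Dynamics.path, hr u hu]
  · intro s hs
    refine ⟨A.leftPath M s, tendsto_const_nhds.congr' ?_⟩
    filter_upwards [hM.reached_Ico (A := A) (y := A.leftPath M) hs.1] with u hu
    rw [Dynamics.path, hu, hM.leftPath_eq]

theorem IsSimple.before_path (hM : IsSimple M) {s : ℝ} (hs : 0 ≤ s) :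
    before (A.path M) s = A.leftPath M s := by
  rcases hs.eq_or_lt with rfl | hpos
  · rw [before_zero, hM.leftPath_eq, Dynamics.path, reached_eq_init (I := Ico 0 0) (by simp),
      reached_eq_init (by simpa using hM.times_zero)]
  · refine before_eq hpos ?_
    filter_upwards [hM.reached_Ico (A := A) (y := A.leftPath M) hpos] with u hu
    rw [Dynamics.path, hu, hM.leftPath_eq]

/-- The path solves the evolution equation. -/
theorem IsSimple.path_eq (hM : IsSimple M) (hA : A.Admissible) {t : ℝ} (ht : 0 ≤ t) (k : Fin 4) :
    (A.path M t k : ℝ) = A.reached M (before (A.path M)) (Icc 0 t) k := by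
  rw [Dynamics.path, clip_reached (hM.reached_mem hA ht)]
  exact congrFun (reached_congr (B := ∅) (by simp) (fun _ _ => Iff.rfl)
    fun u _ hu => (hM.before_path hu.1).symm) k

/-! ### The station for given mean-field functions -/

/-- The measure itself if it is finite, and `0` otherwise. With this convention the path becomes a
measurable function on the space of all families of measures. -/
def cut (M : Measure (ℝ × ℝ)) : Measure (ℝ × ℝ) := open Classical in if M univ < ∞ then M else 0

theorem measurable_cut : Measurable cut :=
  Measurable.ite (measurableSet_lt (Measure.measurable_coe .univ) measurable_const)
    measurable_id measurable_const

instance isFiniteMeasure_cut (M : Measure (ℝ × ℝ)) : IsFiniteMeasure (cut M) := by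
  unfold cut
  split_ifs with h
  · exact ⟨h⟩
  · infer_instance

theorem cut_eq (M : Measure (ℝ × ℝ)) [IsFiniteMeasure M] : cut M = M :=
  if_pos (measure_lt_top M univ)

theorem cut_apply_eq_zero {M : Measure (ℝ × ℝ)} {D : Set (ℝ × ℝ)} (h : M D = 0) :
    cut M D = 0 := by
  unfold cut
  split_ifs
  · exact h
  · rfl

section Measurability

variable {ι : Type*} [Fintype ι] {A : Dynamics ι}

theorem measurable_clip (K : ℕ) : Measurable (clip K) := by
  have h : Measurable fun (x : Fin 4 → ℝ) k => ⌊x k⌋₊ :=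
    measurable_pi_lambda _ fun k => Nat.measurable_floor.comp (measurable_pi_apply k)
  exact Measurable.ite (h (Set.to_countable {q : State | total q ≤ K}).measurableSet) h
    measurable_const

/-- Finite measures form a kernel over the space of measures, and integrals of jointly measurable
functions with respect to a kernel are measurable. -/
theorem measurable_reached (hA : ∀ i q, Measurable fun s => A.rate i s q)
    {y : (ι → Measure (ℝ × ℝ)) → ℝ → State}
    (hy : Measurable fun p : (ι → Measure (ℝ × ℝ)) × ℝ => y p.1 p.2) {I : ℝ → Set ℝ}
    (hI : MeasurableSet {p : ℝ × ℝ | p.2 ∈ I p.1}) :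
    Measurable fun p : (ι → Measure (ℝ × ℝ)) × ℝ =>
      A.reached (fun i => cut (p.1 i)) (y p.1) (I p.2) := by
  refine measurable_pi_lambda _ fun k => Measurable.add measurable_const ?_
  refine Finset.measurable_sum _ fun i _ => Measurable.mul measurable_const ?_
  refine Measurable.ennreal_toReal ?_
  let κ : Kernel ((ι → Measure (ℝ × ℝ)) × ℝ) (ℝ × ℝ) :=
    ⟨fun p => cut (p.1 i), measurable_cut.comp ((measurable_pi_apply i).comp measurable_fst)⟩
  have hrate : Measurable fun p : ℝ × State => A.rate i p.1 p.2 :=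
    measurable_from_prod_countable_left fun q => hA i q
  let t : Set (((ι → Measure (ℝ × ℝ)) × ℝ) × (ℝ × ℝ)) :=
    {x | x.2 ∈ hits (fun s => A.rate i s (y x.1.1 s)) (I x.1.2)}
  have ht : MeasurableSet t := by
    have h1 : MeasurableSet {x : ((ι → Measure (ℝ × ℝ)) × ℝ) × (ℝ × ℝ) | x.2.1 ∈ I x.1.2} :=
      (show Measurable fun x : ((ι → Measure (ℝ × ℝ)) × ℝ) × (ℝ × ℝ) => (x.1.2, x.2.1) by
        fun_prop) hI
    have h2 : MeasurableSet {x : ((ι → Measure (ℝ × ℝ)) × ℝ) × (ℝ × ℝ) | 0 ≤ x.2.2} :=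
      measurableSet_le measurable_const (by fun_prop)
    have h3 : Measurable fun x : ((ι → Measure (ℝ × ℝ)) × ℝ) × (ℝ × ℝ) =>
        A.rate i x.2.1 (y x.1.1 x.2.1) := by
      have hy' : Measurable fun x : ((ι → Measure (ℝ × ℝ)) × ℝ) × (ℝ × ℝ) => y x.1.1 x.2.1 :=
        hy.comp (show Measurable fun x : ((ι → Measure (ℝ × ℝ)) × ℝ) × (ℝ × ℝ) =>
          (x.1.1, x.2.1) by fun_prop)
      exact hrate.comp (Measurable.prodMk (by fun_prop) hy')
    have h4 := measurableSet_le (show Measurable fun x : ((ι → Measure (ℝ × ℝ)) × ℝ) × (ℝ × ℝ) =>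
      x.2.2 by fun_prop) h3
    exact h1.inter (h2.inter h4)
  exact Kernel.measurable_kernel_prodMk_left_of_finite (κ := κ) ht
    fun p => isFiniteMeasure_cut (p.1 i)

theorem measurable_picard (hA : ∀ i q, Measurable fun s => A.rate i s q) (m : ℕ) :
    Measurable fun p : (ι → Measure (ℝ × ℝ)) × ℝ => A.picard (fun i => cut (p.1 i)) m p.2 := by
  induction m with
  | zero => exact measurable_const
  | succ m ih =>
    refine (measurable_clip A.K).comp (measurable_reached hA
      (y := fun M => A.picard (fun i => cut (M i)) m) ih (I := fun s => Ico 0 s) ?_)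
    exact (measurableSet_le measurable_const measurable_snd).inter
      (measurableSet_lt measurable_snd measurable_fst)

theorem measurable_leftPath (hA : ∀ i q, Measurable fun s => A.rate i s q) :
    Measurable fun p : (ι → Measure (ℝ × ℝ)) × ℝ => A.leftPath (fun i => cut (p.1 i)) p.2 := by
  have h : Measurable fun x : ℕ × ((ι → Measure (ℝ × ℝ)) × ℝ) =>
      A.picard (fun i => cut (x.2.1 i)) x.1 x.2.2 :=
    measurable_from_prod_countable_right fun m => measurable_picard hA m
  have hn : Measurable fun M : ι → Measure (ℝ × ℝ) =>
      ⌈(∑ i, cut (M i) univ).toReal⌉₊ + 1 := by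
    refine (Nat.measurable_ceil.comp (Measurable.ennreal_toReal ?_)).add_const 1
    exact Finset.measurable_sum _ fun i _ =>
      (Measure.measurable_coe .univ).comp (measurable_cut.comp (measurable_pi_apply i))
  exact h.comp ((hn.comp measurable_fst).prodMk measurable_id)

theorem measurable_path (hA : ∀ i q, Measurable fun s => A.rate i s q) (t : ℝ) :
    Measurable fun M : ι → Measure (ℝ × ℝ) => A.path (fun i => cut (M i)) t := by
  have h : Measurable fun p : (ι → Measure (ℝ × ℝ)) × ℝ =>
      A.reached (fun i => cut (p.1 i)) (A.leftPath fun i => cut (p.1 i)) (Icc 0 p.2) :=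
    measurable_reached hA (y := fun M => A.leftPath fun i => cut (M i)) (measurable_leftPath hA)
      (I := fun s => Icc 0 s) ((measurableSet_le measurable_const measurable_snd).inter
        (measurableSet_le measurable_snd measurable_fst))
  have h' : Measurable fun M : ι → Measure (ℝ × ℝ) =>
      A.reached (fun i => cut (M i)) (A.leftPath fun i => cut (M i)) (Icc 0 t) :=
    Measurable.comp (g := fun p : (ι → Measure (ℝ × ℝ)) × ℝ =>
      A.reached (fun i => cut (p.1 i)) (A.leftPath fun i => cut (p.1 i)) (Icc 0 p.2))
      (f := fun M => (M, t)) h measurable_prodMk_right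
  exact (measurable_clip A.K).comp h'

end Measurability

/-- The driving processes that matter: `lam1`, `lam2`, `nu1`, `nu2` and `mu l` for `l < K`. -/
abbrev Channel (K : ℕ) : Type := Fin 4 ⊕ Fin K

/-- The rates of the station when `(ρ s).1 = ℙ(V(s-) > 0)` and `(ρ s).2 = ℙ(S(s-) < K)` are
given functions. -/
def stationRate (K : ℕ) (ρ : ℝ → ℝ × ℝ) : Channel K → ℝ → State → ℝ
  | .inl 0, s, q => if total q < K then (ρ s).1 else 0
  | .inl 1, s, q => if 0 < q 2 then (ρ s).2 else 0
  | .inl 2, _, q => q 0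
  | .inl 3, _, q => q 3
  | .inr l, _, q => if (l : ℕ) + 1 ≤ q 1 then 1 else 0

/-- The changes of `(r^r, r, v, v^r)` at the points of the driving processes. -/
def stationJump (K : ℕ) : Channel K → Fin 4 → ℝ
  | .inl 0 => ![1, 0, 0, 0]
  | .inl 1 => ![0, 0, -1, 1]
  | .inl 2 => ![-1, 1, 0, 0]
  | .inl 3 => ![0, 0, 0, -1]
  | .inr _ => ![0, -1, 1, 0]

/-- The dynamics of the station for given mean-field functions `ρ`. -/
def station (K : ℕ) (q : State) (ρ : ℝ → ℝ × ℝ) : Dynamics (Channel K) where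
  rate := stationRate K ρ
  jump := stationJump K
  K := K
  init := q

theorem station_admissible {K : ℕ} {q : State} (hq : q ∈ chi K) (ρ : ℝ → ℝ × ℝ) :
    (station K q ρ).Admissible := by
  refine ⟨hq, ?_⟩
  rintro (i | l) s q' hq' hpos
  · have hq' : q' 0 + q' 1 + q' 2 + q' 3 ≤ K := by
      simpa [chi, total, Fin.sum_univ_four, station] using hq'
    fin_cases i
    · have h : q' 0 + q' 1 + q' 2 + q' 3 < K := by
        by_contra hn
        simp [station, stationRate, total, Fin.sum_univ_four, hn] at hpos
      refine ⟨![q' 0 + 1, q' 1, q' 2, q' 3], ?_, fun k => ?_⟩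
      · simp [chi, total, Fin.sum_univ_four, station]; omega
      · fin_cases k <;> simp [station, stationJump]
    · have h : 0 < q' 2 := by
        by_contra hn
        simp [station, stationRate, hn] at hpos
      obtain ⟨n, hn⟩ := Nat.exists_eq_add_of_le' h
      refine ⟨![q' 0, q' 1, n, q' 3 + 1], ?_, fun k => ?_⟩
      · simp [chi, total, Fin.sum_univ_four, station]; omega
      · fin_cases k <;> simp [station, stationJump, hn]
    · have h : 0 < q' 0 := by simpa [station, stationRate] using hpos
      obtain ⟨n, hn⟩ := Nat.exists_eq_add_of_le' h
      refine ⟨![n, q' 1 + 1, q' 2, q' 3], ?_, fun k => ?_⟩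
      · simp [chi, total, Fin.sum_univ_four, station]; omega
      · fin_cases k <;> simp [station, stationJump, hn]
    · have h : 0 < q' 3 := by simpa [station, stationRate] using hpos
      obtain ⟨n, hn⟩ := Nat.exists_eq_add_of_le' h
      refine ⟨![q' 0, q' 1, q' 2, n], ?_, fun k => ?_⟩
      · simp [chi, total, Fin.sum_univ_four, station]; omega
      · fin_cases k <;> simp [station, stationJump, hn]
  · have hq' : q' 0 + q' 1 + q' 2 + q' 3 ≤ K := by
      simpa [chi, total, Fin.sum_univ_four, station] using hq'
    have h : 0 < q' 1 := by
      by_contra hn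
      have : ¬ ((l : ℕ) + 1 ≤ q' 1) := by omega
      simp [station, stationRate, this] at hpos
    obtain ⟨n, hn⟩ := Nat.exists_eq_add_of_le' h
    refine ⟨![q' 0, n, q' 2 + 1, q' 3], ?_, fun k => ?_⟩
    · simp [chi, total, Fin.sum_univ_four, station]; omega
    · fin_cases k <;> simp [station, stationJump, hn]

theorem measurable_stationRate {K : ℕ} (q : State) {ρ : ℝ → ℝ × ℝ} (hρ : Measurable ρ)
    (i : Channel K) (q' : State) : Measurable fun s => (station K q ρ).rate i s q' := by
  rcases i with i | l
  · fin_cases i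
    · simp only [station, stationRate]
      split_ifs <;> fun_prop
    · simp only [station, stationRate]
      split_ifs <;> fun_prop
    · exact measurable_const
    · exact measurable_const
  · exact measurable_const

/-- The points between the graphs of `f` and `g` over `[0, s]`. -/
def gap (f g : ℝ → ℝ) (s : ℝ) : Set (ℝ × ℝ) :=
  {p | p.1 ∈ Icc 0 s ∧ min (f p.1) (g p.1) < p.2 ∧ p.2 ≤ max (f p.1) (g p.1)}

theorem measurableSet_gap {f g : ℝ → ℝ} (hf : Measurable f) (hg : Measurable g) (s : ℝ) :
    MeasurableSet (gap f g s) :=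
  (measurable_fst measurableSet_Icc).inter
    ((measurableSet_lt (by fun_prop) measurable_snd).inter
      (measurableSet_le measurable_snd (by fun_prop)))

theorem volume_gap {f g : ℝ → ℝ} (hf : Measurable f) (hg : Measurable g) (s : ℝ) :
    volume (gap f g s) = ∫⁻ u in Icc 0 s, edist (f u) (g u) := by
  rw [Measure.volume_eq_prod, Measure.prod_apply (measurableSet_gap hf hg s),
    ← lintegral_indicator measurableSet_Icc]
  refine lintegral_congr fun u => ?_
  by_cases hu : u ∈ Icc 0 s
  · rw [indicator_of_mem hu]
    have : Prod.mk u ⁻¹' gap f g s = Ioc (min (f u) (g u)) (max (f u) (g u)) := by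
      ext h; exact and_iff_right hu
    rw [this, Real.volume_Ioc, max_sub_min_eq_abs, edist_dist, Real.dist_eq, abs_sub_comm]
  · rw [indicator_of_notMem hu]
    have : Prod.mk u ⁻¹' gap f g s = ∅ := by
      ext h; exact ⟨fun h' => hu h'.1, fun h' => h'.elim⟩
    rw [this, measure_empty]

theorem gap_mono (f g : ℝ → ℝ) {s t : ℝ} (hst : s ≤ t) : gap f g s ⊆ gap f g t :=
  fun _ hp => ⟨⟨hp.1.1, hp.1.2.trans hst⟩, hp.2⟩

/-- The measures of reservations have no point between the graphs of the components of the mean-field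
functions `ρ` and `ρ'` up to time `s`. -/
def NoGap {K : ℕ} (M : Channel K → Measure (ℝ × ℝ)) (ρ ρ' : ℝ → ℝ × ℝ) (s : ℝ) : Prop :=
  M (.inl 0) (gap (fun u => (ρ u).1) (fun u => (ρ' u).1) s) = 0 ∧
  M (.inl 1) (gap (fun u => (ρ u).2) (fun u => (ρ' u).2) s) = 0

theorem NoGap.symm {K : ℕ} {M : Channel K → Measure (ℝ × ℝ)} {ρ ρ' : ℝ → ℝ × ℝ} {s : ℝ}
    (h : NoGap M ρ ρ' s) : NoGap M ρ' ρ s := by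
  unfold NoGap gap at *
  simp only [min_comm, max_comm] at *
  exact h

theorem NoGap.mono {K : ℕ} {M : Channel K → Measure (ℝ × ℝ)} {ρ ρ' : ℝ → ℝ × ℝ} {s t : ℝ}
    (h : NoGap M ρ ρ' t) (hst : s ≤ t) : NoGap M ρ ρ' s :=
  ⟨measure_mono_null (gap_mono _ _ hst) h.1,
    measure_mono_null (gap_mono _ _ hst) h.2⟩

theorem NoGap.measure_hits_le {K : ℕ} {M : Channel K → Measure (ℝ × ℝ)} {ρ ρ' : ℝ → ℝ × ℝ}
    {s : ℝ} (h : NoGap M ρ ρ' s) (y : ℝ → State) {I : Set ℝ} (hI : I ⊆ Icc 0 s) (i : Channel K) :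
    M i (hits (fun u => stationRate K ρ i u (y u)) I) ≤
      M i (hits (fun u => stationRate K ρ' i u (y u)) I) := by
  have aux : ∀ {N : Measure (ℝ × ℝ)} {f g : ℝ → ℝ} {p : State → Prop} [DecidablePred p],
      N (gap f g s) = 0 → N (hits (fun u => if p (y u) then f u else 0) I) ≤
        N (hits (fun u => if p (y u) then g u else 0) I) := by
    intro N f g p _ h0
    refine (measure_mono (t := hits (fun u => if p (y u) then g u else 0) I ∪ gap f g s)
      fun x hx => ?_).trans ((measure_union_le _ _).trans (by rw [h0, add_zero]))
    by_cases hp : p (y x.1)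
    · have hx2 : x.2 ≤ f x.1 := by simpa [hp] using hx.2.2
      by_cases hg : x.2 ≤ g x.1
      · exact Or.inl ⟨hx.1, hx.2.1, by simpa [hp] using hg⟩
      · exact Or.inr ⟨hI hx.1, (min_le_right _ _).trans_lt (not_le.1 hg),
          hx2.trans (le_max_left _ _)⟩
    · exact Or.inl ⟨hx.1, hx.2.1, by simpa [hp] using hx.2.2⟩
  rcases i with i | l
  · fin_cases i
    · exact aux (p := fun q => total q < K) h.1
    · exact aux (p := fun q => 0 < q 2) h.2
    · exact le_rfl
    · exact le_rfl
  · exact le_rfl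

/-- The coupling: without points between the graphs of `ρ` and `ρ'`, the mean-field functions
cannot be told apart. -/
theorem NoGap.reached_congr {K : ℕ} {M : Channel K → Measure (ℝ × ℝ)} {ρ ρ' : ℝ → ℝ × ℝ}
    {s : ℝ} (h : NoGap M ρ ρ' s) (q : State) {y y' : ℝ → State} {I B : Set ℝ} (hI : I ⊆ Icc 0 s)
    (hB : times M B = 0) (hy : ∀ u ∈ I, u ∉ B → y u = y' u) :
    (station K q ρ).reached M y I = (station K q ρ').reached M y' I := by
  rw [CarSharing.reached_congr hB (fun _ _ => Iff.rfl) fun u hu hI => hy u hI hu]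
  ext k
  simp only [Dynamics.reached]
  congr 1
  refine Finset.sum_congr rfl fun i _ => ?_
  refine congrArg (fun x : ℝ≥0∞ => stationJump K i k * x.toReal) ?_
  exact le_antisymm (h.measure_hits_le y' hI i) (h.symm.measure_hits_le y' hI i)

theorem NoGap.leftPath_eq {K : ℕ} {M : Channel K → Measure (ℝ × ℝ)} {ρ ρ' : ℝ → ℝ × ℝ}
    {s : ℝ} (h : NoGap M ρ ρ' s) (q : State) :
    (station K q ρ).leftPath M s = (station K q ρ').leftPath M s := by
  have key : ∀ m, ∀ u ≤ s, (station K q ρ).picard M m u = (station K q ρ').picard M m u := by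
    intro m
    induction m with
    | zero => intro u _; rfl
    | succ m ih =>
      intro u hu
      simp only [Dynamics.picard]
      rw [h.reached_congr q (fun v hv => ⟨hv.1, hv.2.le.trans hu⟩) (B := ∅) (by simp)
        fun v hv _ => ih v (hv.2.le.trans hu)]
      rfl
  exact key _ s le_rfl

/-- Pathwise uniqueness, in the form of a coupling of the solutions for two mean-field
functions. -/
theorem NoGap.eq_of_reached {K : ℕ} {M : Channel K → Measure (ℝ × ℝ)} {ρ ρ' : ℝ → ℝ × ℝ}
    {T : ℝ} (h : NoGap M ρ ρ' T) {q : State} {z z' : ℝ → State} (hM : times M {0} = 0)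
    (hz : IsCadlagOn T z) (hz' : IsCadlagOn T z')
    (he : ∀ t ∈ Icc 0 T, ∀ k, (z t k : ℝ) = (station K q ρ).reached M (before z) (Icc 0 t) k)
    (he' : ∀ t ∈ Icc 0 T, ∀ k, (z' t k : ℝ) = (station K q ρ').reached M (before z') (Icc 0 t) k) :
    ∀ t ∈ Icc 0 T, z t = z' t := by
  refine forall_mem_Icc_of_step ?_ ?_
  · intro t ht ih
    have : (station K q ρ).reached M (before z) (Icc 0 t) =
        (station K q ρ').reached M (before z') (Icc 0 t) := by
      refine (h.mono ht.2).reached_congr q subset_rfl hM fun u hu hu0 => ?_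
      have hpos : 0 < u := lt_of_le_of_ne hu.1 fun h => hu0 h.symm
      exact before_congr hz ⟨hu.1, hu.2.trans ht.2⟩
        (fun v hv => ih v ⟨hv.1, hv.2.trans_le hu.2⟩) (ih 0 ⟨le_rfl, hpos.trans_le hu.2⟩)
    ext k
    have hk := he t ht k
    rw [this, ← he' t ht k] at hk
    exact_mod_cast hk
  · intro t ht heq
    obtain ⟨ε, hε, h1⟩ := hz.eventually_eq_right ht
    obtain ⟨ε', hε', h2⟩ := hz'.eventually_eq_right ht
    refine ⟨min ε ε', lt_min hε hε', fun u hu => ?_⟩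
    rw [h1 u ⟨hu.1, by linarith [hu.2, min_le_left ε ε']⟩,
      h2 u ⟨hu.1, by linarith [hu.2, min_le_right ε ε']⟩, heq]

/-! ### The mean-field equation -/

section MeanField

variable {Ω : Type*} [MeasurableSpace Ω] {P : Measure Ω}

/-- The probabilities `(ℙ(V > 0), ℙ(S < K))` for a random state. -/
def meanField (P : Measure Ω) (K : ℕ) (Y : Ω → State) : ℝ × ℝ :=
  (P.real {ω | 0 < Y ω 2}, P.real {ω | total (Y ω) < K})

/-- The `ℓ¹` distance on `ℝ × ℝ`. -/
def dist1 (x y : ℝ × ℝ) : ℝ≥0∞ := edist x.1 y.1 + edist x.2 y.2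

theorem measurable_dist1 {ρ ρ' : ℝ → ℝ × ℝ} (hρ : Measurable ρ) (hρ' : Measurable ρ') :
    Measurable fun s => dist1 (ρ s) (ρ' s) :=
  (hρ.fst.edist hρ'.fst).add (hρ.snd.edist hρ'.snd)

theorem edist_le_dist1 (x y : ℝ × ℝ) : edist x y ≤ dist1 x y := by
  rw [Prod.edist_eq]
  exact max_le (le_add_right le_rfl) (le_add_left le_rfl)

theorem dist1_le_two {x y : ℝ × ℝ} (hx : x ∈ Icc 0 1) (hy : y ∈ Icc 0 1) : dist1 x y ≤ 2 := by
  have aux : ∀ {a b : ℝ}, a ∈ Icc 0 1 → b ∈ Icc 0 1 → edist a b ≤ 1 := by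
    intro a b ha hb
    rw [edist_dist, Real.dist_eq, ← ENNReal.ofReal_one]
    exact ENNReal.ofReal_le_ofReal
      (abs_le.2 ⟨by linarith [ha.1, hb.2], by linarith [ha.2, hb.1]⟩)
  rw [← one_add_one_eq_two]
  exact add_le_add (aux ⟨hx.1.1, hx.2.1⟩ ⟨hy.1.1, hy.2.1⟩) (aux ⟨hx.1.2, hx.2.2⟩ ⟨hy.1.2, hy.2.2⟩)

theorem meanField_mem [IsProbabilityMeasure P] (K : ℕ) (Y : Ω → State) :
    meanField P K Y ∈ Icc 0 1 :=
  ⟨⟨measureReal_nonneg, measureReal_nonneg⟩, ⟨measureReal_le_one, measureReal_le_one⟩⟩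

theorem edist_measureReal_le [IsFiniteMeasure P] {A B C : Set Ω}
    (h : ∀ ω ∉ C, (ω ∈ A ↔ ω ∈ B)) : edist (P.real A) (P.real B) ≤ P C := by
  have aux : ∀ {A B : Set Ω}, (∀ ω ∉ C, (ω ∈ A ↔ ω ∈ B)) → P.real A - P.real B ≤ P.real C := by
    intro A B h
    rw [sub_le_iff_le_add']
    refine (measureReal_mono (s₂ := B ∪ C) fun ω hω => ?_).trans (measureReal_union_le _ _)
    by_cases hC : ω ∈ C
    · exact Or.inr hC
    · exact Or.inl ((h ω hC).1 hω)
  rw [edist_dist, Real.dist_eq, ← ofReal_measureReal]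
  exact ENNReal.ofReal_le_ofReal
    (abs_sub_le_iff.2 ⟨aux h, aux fun ω hω => (h ω hω).symm⟩)

theorem dist1_meanField_le [IsFiniteMeasure P] (K : ℕ) {Y Y' : Ω → State} {C : Set Ω}
    (h : ∀ ω ∉ C, Y ω = Y' ω) : dist1 (meanField P K Y) (meanField P K Y') ≤ 2 * P C := by
  rw [two_mul]
  exact add_le_add (edist_measureReal_le fun ω hω => by simp [h ω hω])
    (edist_measureReal_le fun ω hω => by simp [h ω hω])

variable {K : ℕ}

/-- The probability that the driving measures of the reservations have a point in `D` is at most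
`lam` times the volume of `D`. -/
def GapBound (P : Measure Ω) (M : Ω → Channel K → Measure (ℝ × ℝ)) (lam : ℝ≥0) : Prop :=
  ∀ D, MeasurableSet D → P {ω | M ω (.inl 0) D ≠ 0} ≤ lam * volume D ∧
    P {ω | M ω (.inl 1) D ≠ 0} ≤ lam * volume D

theorem GapBound.measure_not_noGap_le {M : Ω → Channel K → Measure (ℝ × ℝ)} {lam : ℝ≥0}
    (h : GapBound P M lam) {ρ ρ' : ℝ → ℝ × ℝ} (hρ : Measurable ρ) (hρ' : Measurable ρ') (s : ℝ) :
    P {ω | ¬ NoGap (M ω) ρ ρ' s} ≤ lam * ∫⁻ u in Icc 0 s, dist1 (ρ u) (ρ' u) := by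
  have h1 := (h _ (measurableSet_gap hρ.fst hρ'.fst s)).1
  have h2 := (h _ (measurableSet_gap hρ.snd hρ'.snd s)).2
  rw [volume_gap hρ.fst hρ'.fst] at h1
  rw [volume_gap hρ.snd hρ'.snd] at h2
  simp only [dist1]
  rw [lintegral_add_left (hρ.fst.edist hρ'.fst), mul_add]
  refine (measure_mono fun ω hω => ?_).trans ((measure_union_le _ _).trans (add_le_add h1 h2))
  by_contra hn
  simp only [mem_union, not_or] at hn
  exact hω ⟨not_not.1 hn.1, not_not.1 hn.2⟩

/-- Random states that agree whenever the mean-field functions `ρ` and `ρ'` cannot be told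
apart have close mean fields. -/
theorem GapBound.dist1_meanField_le [IsFiniteMeasure P] {M : Ω → Channel K → Measure (ℝ × ℝ)}
    {lam : ℝ≥0} (h : GapBound P M lam) {ρ ρ' : ℝ → ℝ × ℝ} (hρ : Measurable ρ)
    (hρ' : Measurable ρ') {s : ℝ} {Y Y' : Ω → State}
    (hY : ∀ᵐ ω ∂P, NoGap (M ω) ρ ρ' s → Y ω = Y' ω) :
    dist1 (meanField P K Y) (meanField P K Y') ≤
      (2 * lam : ℝ≥0) * ∫⁻ u in Icc 0 s, dist1 (ρ u) (ρ' u) := by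
  refine (CarSharing.dist1_meanField_le K (C := {ω | ¬ NoGap (M ω) ρ ρ' s} ∪
    {ω | ¬ (NoGap (M ω) ρ ρ' s → Y ω = Y' ω)}) fun ω hω => ?_).trans ?_
  · simp only [mem_union, not_or] at hω
    exact not_not.1 hω.2 (not_not.1 hω.1)
  · rw [ENNReal.coe_mul, mul_assoc, ENNReal.coe_ofNat]
    gcongr
    refine (measure_union_le _ _).trans ?_
    rw [ae_iff.1 hY, add_zero]
    exact h.measure_not_noGap_le hρ hρ' s

/-- The mean field, just before each time, of the station with given mean-field functions,
when `Q` is the law of the driving measures. -/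
def meanFieldMap (Q : Measure (Channel K → Measure (ℝ × ℝ))) (q : State) (ρ : ℝ → ℝ × ℝ) (s : ℝ) :
    ℝ × ℝ :=
  meanField Q K fun M => (station K q ρ).leftPath (fun i => cut (M i)) s

theorem measurable_meanFieldMap (Q : Measure (Channel K → Measure (ℝ × ℝ)))
    [IsProbabilityMeasure Q] (q : State) {ρ : ℝ → ℝ × ℝ} (hρ : Measurable ρ) :
    Measurable (meanFieldMap Q q ρ) := by
  have h := measurable_leftPath (measurable_stationRate (K := K) q hρ)
  have aux : ∀ B : Set State, Measurable fun s =>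
      Q.real {M | (station K q ρ).leftPath (fun i => cut (M i)) s ∈ B} := fun B =>
    (measurable_measure_prodMk_right (μ := Q)
      (h (Set.to_countable B).measurableSet)).ennreal_toReal
  exact (aux {x | 0 < x 2}).prodMk (aux {x | total x < K})

/-- The mean-field equation has a solution, which depends on the law of the driving measures
only. -/
theorem GapBound.exists_meanField {Q : Measure (Channel K → Measure (ℝ × ℝ))}
    [IsProbabilityMeasure Q] {lam : ℝ≥0} (h : GapBound Q id lam) (q : State) :
    ∃ ρ : ℝ → ℝ × ℝ, Measurable ρ ∧ meanFieldMap Q q ρ = ρ := by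
  have hle : ∀ i D, Q {M | cut (M i) D ≠ 0} ≤ Q {M | M i D ≠ 0} := fun i D =>
    measure_mono fun M (hM : cut (M i) D ≠ 0) (h0 : M i D = 0) => hM (cut_apply_eq_zero h0)
  have hcut : GapBound Q (fun M i => cut (M i)) lam := fun D hD =>
    ⟨(hle _ D).trans (h D hD).1, (hle _ D).trans (h D hD).2⟩
  have hstep : ∀ {ρ ρ' : ℝ → ℝ × ℝ}, Measurable ρ → Measurable ρ' → ∀ s,
      dist1 (meanFieldMap Q q ρ s) (meanFieldMap Q q ρ' s) ≤
        (2 * lam : ℝ≥0) * ∫⁻ u in Icc 0 s, dist1 (ρ u) (ρ' u) := fun hρ hρ' s =>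
    hcut.dist1_meanField_le hρ hρ' (ae_of_all _ fun M hM => hM.leftPath_eq q)
  let r : ℕ → ℝ → ℝ × ℝ := fun n => (meanFieldMap Q q)^[n] 0
  have hsucc : ∀ n, r (n + 1) = meanFieldMap Q q (r n) := fun n =>
    Function.iterate_succ_apply' _ _ _
  have hr : ∀ n, Measurable (r n) := by
    intro n
    induction n with
    | zero => exact measurable_const
    | succ n ih => rw [hsucc]; exact measurable_meanFieldMap Q q ih
  have hmem : ∀ n s, r n s ∈ Icc (0 : ℝ × ℝ) 1 := by
    intro n s
    cases n with
    | zero => exact ⟨le_rfl, zero_le_one⟩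
    | succ n => rw [hsucc]; exact meanField_mem K _
  have hcauchy : ∀ s, CauchySeq fun n => r n s := by
    intro s
    refine cauchySeq_of_edist_le_of_tsum_ne_top
      (fun n => 2 * ENNReal.ofReal (((2 * lam : ℝ≥0) * max s 0) ^ n / n.factorial)) ?_
      (tsum_volterra_ne_top ENNReal.ofNat_ne_top _ (le_max_right _ _))
    intro n
    refine (edist_le_dist1 _ _).trans ?_
    have h0 : ∀ s, dist1 (r 0 s) (r 1 s) ≤ 2 := fun s => dist1_le_two (hmem 0 s) (hmem 1 s)
    have h1 : ∀ n s, dist1 (r (n + 1) s) (r (n + 1 + 1) s) ≤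
        (2 * lam : ℝ≥0) * ∫⁻ u in Icc 0 s, dist1 (r n u) (r (n + 1) u) := by
      intro n s
      have := hstep (hr n) (hr (n + 1)) s
      rwa [← hsucc, ← hsucc] at this
    rcases le_or_gt 0 s with hs | hs
    · rw [max_eq_left hs]
      exact volterra_iterate (d := fun n s => dist1 (r n s) (r (n + 1) s)) h0 h1 n hs
    · cases n with
      | zero => simpa using h0 s
      | succ n =>
        refine (h1 n s).trans ?_
        simp [Icc_eq_empty (not_le.2 hs)]
  -- the limit `ρ` of the iterates is a fixed point, because the image of `ρ` is their limit as well
  choose ρ hρ using fun s => cauchySeq_tendsto_of_complete (hcauchy s)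
  have hρm : Measurable ρ := measurable_of_tendsto_metrizable hr (tendsto_pi_nhds.2 hρ)
  have hρmem : ∀ s, ρ s ∈ Icc (0 : ℝ × ℝ) 1 := fun s =>
    isClosed_Icc.mem_of_tendsto (hρ s) (Eventually.of_forall fun n => hmem n s)
  refine ⟨ρ, hρm, funext fun s => ?_⟩
  refine tendsto_nhds_unique (f := fun n => r (n + 1) s) ?_ ((tendsto_add_atTop_iff_nat 1).2 (hρ s))
  have hint : Tendsto (fun n => ∫⁻ u in Icc 0 s, dist1 (r n u) (ρ u)) atTop
      (𝓝 (∫⁻ u in Icc 0 s, 0)) := by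
    refine tendsto_lintegral_of_dominated_convergence (fun _ => 2)
      (fun n => measurable_dist1 (hr n) hρm) (fun n => ae_of_all _ fun u =>
        dist1_le_two (hmem n u) (hρmem u)) ?_ (ae_of_all _ fun u => ?_)
    · simp [ENNReal.mul_eq_top]
    · have h1 := tendsto_iff_edist_tendsto_0.1 ((continuous_fst.tendsto _).comp (hρ u))
      have h2 := tendsto_iff_edist_tendsto_0.1 ((continuous_snd.tendsto _).comp (hρ u))
      simpa [dist1] using h1.add h2
  rw [lintegral_zero] at hint
  have hint' := ENNReal.Tendsto.const_mul (a := ((2 * lam : ℝ≥0) : ℝ≥0∞)) hint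
    (Or.inr ENNReal.coe_ne_top)
  rw [mul_zero] at hint'
  rw [tendsto_iff_edist_tendsto_0]
  refine tendsto_of_tendsto_of_tendsto_of_le_of_le tendsto_const_nhds hint' (fun n => zero_le)
    fun n => ?_
  simp only [hsucc]
  exact (edist_le_dist1 _ _).trans (hstep (hr n) hρm s)

end MeanField

section Uniqueness

variable {Ω : Type*} [MeasurableSpace Ω] {P : Measure Ω} {K : ℕ} {T : ℝ}

/-- Times `gridBefore n s < s` in a countable set, that tend to `s`. -/
def gridBefore (n : ℕ) (s : ℝ) : ℝ := (⌈s * (n + 1)⌉ - 1) / (n + 1)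

theorem gridBefore_lt (n : ℕ) (s : ℝ) : gridBefore n s < s := by
  have hn : (0 : ℝ) < n + 1 := by positivity
  rw [gridBefore, div_lt_iff₀ hn]
  linarith [Int.ceil_lt_add_one (s * (n + 1))]

theorem gridBefore_nonneg (n : ℕ) {s : ℝ} (hs : 0 < s) : 0 ≤ gridBefore n s := by
  have hn : (0 : ℝ) < n + 1 := by positivity
  refine div_nonneg ?_ hn.le
  have : 0 < ⌈s * (n + 1)⌉ := Int.ceil_pos.2 (by positivity)
  have : (1 : ℝ) ≤ ⌈s * (n + 1)⌉ := by exact_mod_cast this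
  linarith

theorem tendsto_gridBefore (s : ℝ) : Tendsto (fun n => gridBefore n s) atTop (𝓝[<] s) := by
  refine tendsto_nhdsWithin_iff.2 ⟨?_, Eventually.of_forall fun n => gridBefore_lt n s⟩
  have h1 : Tendsto (fun n : ℕ => s - 1 / ((n : ℝ) + 1)) atTop (𝓝 (s - 0)) :=
    tendsto_const_nhds.sub tendsto_one_div_add_atTop_nhds_zero_nat
  rw [sub_zero] at h1
  refine tendsto_of_tendsto_of_tendsto_of_le_of_le h1 tendsto_const_nhds (fun n => ?_)
    fun n => (gridBefore_lt n s).le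
  have hn : (0 : ℝ) < n + 1 := by positivity
  simp only [gridBefore]
  rw [sub_le_iff_le_add, ← add_div, le_div_iff₀ hn]
  linarith [Int.le_ceil (s * (n + 1))]

variable {Z : ℝ → Ω → State}

/-- Mean fields of a cadlag process are measurable functions of time. -/
theorem measurable_meanField_before [IsFiniteMeasure P] (hm : ∀ t ∈ Icc 0 T, Measurable (Z t))
    (hc : ∀ ω, IsCadlagOn T fun t => Z t ω) :
    Measurable ((Ioc 0 T).indicator fun s => meanField P K fun ω => before (fun u => Z u ω) s) := by
  have aux : ∀ B : Set State, Measurable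
      ((Ioc 0 T).indicator fun s => P.real {ω | before (fun u => Z u ω) s ∈ B}) := by
    intro B
    refine measurable_of_tendsto_metrizable (f := fun n =>
      (Ioc 0 T).indicator fun s => P.real {ω | Z (gridBefore n s) ω ∈ B}) (fun n => ?_)
      (tendsto_pi_nhds.2 fun s => ?_)
    · refine Measurable.indicator ?_ measurableSet_Ioc
      exact (measurable_of_countable
        fun k : ℤ => P.real {ω | Z (((k : ℝ) - 1) / (n + 1)) ω ∈ B}).comp
        (Int.measurable_ceil.comp (measurable_id.mul_const ((n : ℝ) + 1)))
    · by_cases hs : s ∈ Ioc 0 T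
      · simp only [indicator_of_mem hs]
        refine (ENNReal.tendsto_toReal (measure_ne_top _ _)).comp ?_
        refine tendsto_measure_of_tendsto_indicator_of_isFiniteMeasure atTop P (fun n => ?_)
          fun ω => ?_
        · exact hm _ ⟨gridBefore_nonneg n hs.1, (gridBefore_lt n s).le.trans hs.2⟩
            (Set.to_countable B).measurableSet
        · filter_upwards [(tendsto_gridBefore s).eventually
            ((hc ω).eventually_eq_before hs)] with n hn
          simp only [hn]
      · simp only [indicator_of_notMem hs]
        exact tendsto_const_nhds
  have h := (aux {x | 0 < x 2}).prodMk (aux {x | total x < K})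
  convert h using 1
  ext s : 1
  by_cases hs : s ∈ Ioc 0 T
  · simp only [indicator_of_mem hs]; rfl
  · simp only [indicator_of_notMem hs]; rfl

theorem reached_station_congr {M : Channel K → Measure (ℝ × ℝ)} (hM : times M {0} = 0)
    {ρ ρ' : ℝ → ℝ × ℝ} {t : ℝ} (h : ∀ u ∈ Ioc 0 t, ρ u = ρ' u) (q : State) (y : ℝ → State) :
    (station K q ρ).reached M y (Icc 0 t) = (station K q ρ').reached M y (Icc 0 t) := by
  ext k
  simp only [Dynamics.reached]
  congr 1
  refine Finset.sum_congr rfl fun i _ => ?_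
  refine congrArg (fun x : ℝ≥0∞ => stationJump K i k * x.toReal) ?_
  refine measure_hits_congr hM (fun _ _ => Iff.rfl) fun u hu0 hu => ?_
  have hu' := h u ⟨lt_of_le_of_ne hu.1 fun h => hu0 h.symm, hu.2⟩
  rcases i with i | l
  · fin_cases i <;> simp [station, stationRate, hu']
  · rfl

/-- Two cadlag processes that solve the mean-field equations are almost surely equal. -/
theorem GapBound.ae_eq [IsProbabilityMeasure P] {M : Ω → Channel K → Measure (ℝ × ℝ)}
    {lam : ℝ≥0} (h : GapBound P M lam) (hM : ∀ᵐ ω ∂P, times (M ω) {0} = 0) {q : State}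
    {Z' : ℝ → Ω → State}
    (hm : ∀ t ∈ Icc 0 T, Measurable (Z t)) (hm' : ∀ t ∈ Icc 0 T, Measurable (Z' t))
    (hc : ∀ ω, IsCadlagOn T fun t => Z t ω) (hc' : ∀ ω, IsCadlagOn T fun t => Z' t ω)
    (he : ∀ᵐ ω ∂P, ∀ t ∈ Icc 0 T, ∀ k, (Z t ω k : ℝ) =
      (station K q fun s => meanField P K fun ω => before (fun u => Z u ω) s).reached (M ω)
        (before fun u => Z u ω) (Icc 0 t) k)
    (he' : ∀ᵐ ω ∂P, ∀ t ∈ Icc 0 T, ∀ k, (Z' t ω k : ℝ) =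
      (station K q fun s => meanField P K fun ω => before (fun u => Z' u ω) s).reached (M ω)
        (before fun u => Z' u ω) (Icc 0 t) k) :
    ∀ᵐ ω ∂P, ∀ t ∈ Icc 0 T, Z t ω = Z' t ω := by
  set ρ : ℝ → ℝ × ℝ := (Ioc 0 T).indicator
    fun s => meanField P K fun ω => before (fun u => Z u ω) s with hρ
  set ρ' : ℝ → ℝ × ℝ := (Ioc 0 T).indicator
    fun s => meanField P K fun ω => before (fun u => Z' u ω) s with hρ'
  have hρm : Measurable ρ := measurable_meanField_before hm hc
  have hρm' : Measurable ρ' := measurable_meanField_before hm' hc'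
  -- outside `(0, T]`, the mean-field functions are set to `0` to make them measurable; the time `0`
  -- is not charged by the driving measures
  have hpath : ∀ᵐ ω ∂P, ∀ s ≤ T, NoGap (M ω) ρ ρ' s → ∀ t ∈ Icc 0 s, Z t ω = Z' t ω := by
    filter_upwards [hM, he, he'] with ω hω hω1 hω2 s hs hg
    refine hg.eq_of_reached (q := q) hω ((hc ω).mono hs) ((hc' ω).mono hs) ?_ ?_
    · intro t ht k
      rw [hω1 t ⟨ht.1, ht.2.trans hs⟩ k]
      refine congrFun (reached_station_congr hω (fun u hu => ?_) _ _) k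
      rw [hρ, indicator_of_mem (show u ∈ Ioc 0 T from ⟨hu.1, hu.2.trans (ht.2.trans hs)⟩)]
    · intro t ht k
      rw [hω2 t ⟨ht.1, ht.2.trans hs⟩ k]
      refine congrFun (reached_station_congr hω (fun u hu => ?_) _ _) k
      rw [hρ', indicator_of_mem (show u ∈ Ioc 0 T from ⟨hu.1, hu.2.trans (ht.2.trans hs)⟩)]
  have hvol : ∀ s, dist1 (ρ s) (ρ' s) ≤
      (2 * lam : ℝ≥0) * ∫⁻ u in Icc 0 s, dist1 (ρ u) (ρ' u) := by
    intro s
    by_cases hs : s ∈ Ioc 0 T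
    · have h1 : ρ s = meanField P K fun ω => before (fun u => Z u ω) s := indicator_of_mem hs _
      have h2 : ρ' s = meanField P K fun ω => before (fun u => Z' u ω) s := indicator_of_mem hs _
      rw [h1, h2]
      refine h.dist1_meanField_le hρm hρm' ?_
      filter_upwards [hpath] with ω hω hg
      have := hω s hs.2 hg
      exact before_congr (hc ω) ⟨hs.1.le, hs.2⟩ (fun u hu => this u ⟨hu.1, hu.2.le⟩)
        (this 0 ⟨le_rfl, hs.1.le⟩)
    · have h1 : ρ s = 0 := indicator_of_notMem hs _
      have h2 : ρ' s = 0 := indicator_of_notMem hs _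
      simp [h1, h2, dist1]
  have hbound : ∀ s, dist1 (ρ s) (ρ' s) ≤ 2 := by
    have : ∀ Z : ℝ → Ω → State, ∀ s, (Ioc 0 T).indicator
        (fun s => meanField P K fun ω => before (fun u => Z u ω) s) s ∈ Icc (0 : ℝ × ℝ) 1 := by
      intro Z s
      by_cases hs : s ∈ Ioc 0 T
      · rw [indicator_of_mem hs]; exact meanField_mem K _
      · rw [indicator_of_notMem hs]; exact ⟨le_rfl, zero_le_one⟩
    exact fun s => dist1_le_two (this Z s) (this Z' s)
  have hzero : ∀ s, 0 ≤ s → dist1 (ρ s) (ρ' s) = 0 := fun s hs =>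
    eq_zero_of_volterra (d := fun s => dist1 (ρ s) (ρ' s)) ENNReal.ofNat_ne_top hbound hvol hs
  have hnogap : ∀ᵐ ω ∂P, NoGap (M ω) ρ ρ' T := by
    have := h.measure_not_noGap_le hρm hρm' T
    rw [setLIntegral_congr_fun (g := fun _ => 0) measurableSet_Icc fun u hu => hzero u hu.1] at this
    rw [ae_iff]
    simpa using this
  filter_upwards [hpath, hnogap] with ω hω hg
  exact hω T le_rfl hg

end Uniqueness

/-! ### Absence of simultaneous points -/

section Simultaneous

variable {Ω : Type*} [MeasurableSpace Ω] {P : Measure Ω} {ι : Type*} [Fintype ι]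
  {M : ι → Ω → Measure (ℝ × ℝ)} {m : ι → Measure (ℝ × ℝ)}

/-- Independent Poisson processes with bounded intensities have two points in a short time interval
with a probability of second order. -/
theorem measure_two_points_le (hM : ∀ i, IsPoissonProcess P (M i) (m i))
    [∀ i, IsFiniteMeasure (m i)] (hind : iIndepFun M P) {S : Set (ℝ × ℝ)} (hS : MeasurableSet S)
    {c : ℝ≥0∞} (hc : ∀ i, m i S ≤ c) :
    P {ω | (∃ i, 2 ≤ M i ω S) ∨ ∃ i j, i ≠ j ∧ M i ω S ≠ 0 ∧ M j ω S ≠ 0} ≤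
      (Fintype.card ι) ^ 2 * c ^ 2 := by
  classical
  let B : ι × ι → Set Ω := fun p =>
    if p.1 = p.2 then {ω | 2 ≤ M p.1 ω S} else {ω | M p.1 ω S ≠ 0} ∩ {ω | M p.2 ω S ≠ 0}
  have hB : ∀ p, P (B p) ≤ c ^ 2 := by
    rintro ⟨i, j⟩
    by_cases hij : i = j
    · simp only [B, if_pos hij]
      exact ((hM i).measure_two_le_le hS (measure_ne_top _ _)).trans (by gcongr; exact hc i)
    · simp only [B, if_neg hij]
      have hms : MeasurableSet {N : Measure (ℝ × ℝ) | N S ≠ 0} :=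
        Measure.measurable_coe hS (measurableSet_singleton 0).compl
      have := (hind.indepFun hij).measure_inter_preimage_eq_mul _ _ hms hms
      refine (this.trans_le ?_)
      rw [sq]
      exact mul_le_mul' (((hM i).measure_ne_zero_le hS (measure_ne_top _ _)).trans (hc i))
        (((hM j).measure_ne_zero_le hS (measure_ne_top _ _)).trans (hc j))
  calc _ ≤ P (⋃ p, B p) := by
        refine measure_mono fun ω hω => ?_
        rcases hω with ⟨i, hi⟩ | ⟨i, j, hij, h⟩
        · exact mem_iUnion.2 ⟨(i, i), by simpa [B] using hi⟩
        · exact mem_iUnion.2 ⟨(i, j), by simpa [B, hij] using h⟩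
    _ ≤ ∑ p, P (B p) := measure_iUnion_fintype_le _ _
    _ ≤ ∑ _p : ι × ι, c ^ 2 := Finset.sum_le_sum fun p _ => hB p
    _ = _ := by simp [sq]

/-- Almost surely, no two points of independent Poisson processes are simultaneous. -/
theorem ae_sum_le_one (hM : ∀ i, IsPoissonProcess P (M i) (m i))
    [∀ i, IsFiniteMeasure (m i)] (hind : iIndepFun M P) {C : ℝ≥0} {T : ℝ} (hT : 0 < T)
    (hC : ∀ i a b, m i (Prod.fst ⁻¹' Icc a b) ≤ C * ENNReal.ofReal (b - a))
    (hsupp : ∀ i ω, ∀ s ∉ Icc 0 T, M i ω (Prod.fst ⁻¹' {s}) = 0) :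
    ∀ᵐ ω ∂P, ∀ s, ∑ i, M i ω (Prod.fst ⁻¹' {s}) ≤ 1 := by
  -- `[0, T]` is covered by at most `n + 2` intervals of length `T / (n + 1)`, each of which contains
  -- two points with a probability of order `n⁻²`
  let S : ℕ → ℕ → Set (ℝ × ℝ) := fun n k =>
    Prod.fst ⁻¹' Icc (k * (T / (n + 1))) ((k + 1) * (T / (n + 1)))
  have hS : ∀ n k, MeasurableSet (S n k) := fun n k => measurable_fst measurableSet_Icc
  let B : ℕ → Set Ω := fun n => ⋃ k ∈ Finset.range (n + 2),
    {ω | (∃ i, 2 ≤ M i ω (S n k)) ∨ ∃ i j, i ≠ j ∧ M i ω (S n k) ≠ 0 ∧ M j ω (S n k) ≠ 0}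
  let c : ℝ := 2 * (Fintype.card ι) ^ 2 * (C * T) ^ 2
  have hB : ∀ n : ℕ, P (B n) ≤ ENNReal.ofReal (c * (1 / ((n : ℝ) + 1))) := by
    intro n
    have hn : (0 : ℝ) < n + 1 := by positivity
    calc P (B n) ≤ ∑ k ∈ Finset.range (n + 2), P {ω | (∃ i, 2 ≤ M i ω (S n k)) ∨
          ∃ i j, i ≠ j ∧ M i ω (S n k) ≠ 0 ∧ M j ω (S n k) ≠ 0} := measure_biUnion_finset_le _ _
      _ ≤ ∑ k ∈ Finset.range (n + 2), (Fintype.card ι : ℝ≥0∞) ^ 2 *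
          (C * ENNReal.ofReal (T / (n + 1))) ^ 2 := by
        refine Finset.sum_le_sum fun k _ => measure_two_points_le hM hind (hS n k) fun i => ?_
        refine (hC i _ _).trans_eq ?_
        congr 2
        ring
      _ = ENNReal.ofReal ((n + 2) * ((Fintype.card ι) ^ 2 * (C * (T / (n + 1))) ^ 2)) := by
        rw [Finset.sum_const, Finset.card_range, nsmul_eq_mul, ENNReal.ofReal_mul (by positivity),
          ENNReal.ofReal_mul (by positivity), ENNReal.ofReal_pow (by positivity),
          ENNReal.ofReal_pow (by positivity), ENNReal.ofReal_mul C.coe_nonneg,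
          ENNReal.ofReal_coe_nnreal, ENNReal.ofReal_natCast]
        congr 1
        rw [← ENNReal.ofReal_natCast]
        push_cast
        rfl
      _ ≤ _ := by
        refine ENNReal.ofReal_le_ofReal ?_
        have h2 : ((n : ℝ) + 2) ≤ 2 * (n + 1) := by linarith
        calc ((n : ℝ) + 2) * ((Fintype.card ι) ^ 2 * (C * (T / (n + 1))) ^ 2)
            ≤ (2 * (n + 1)) * ((Fintype.card ι) ^ 2 * (C * (T / (n + 1))) ^ 2) := by gcongr
          _ = _ := by simp only [c]; field_simp
  have hnull : P (⋂ n, B n) = 0 := by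
    have hlim : Tendsto (fun n : ℕ => ENNReal.ofReal (c * (1 / ((n : ℝ) + 1)))) atTop
        (𝓝 (ENNReal.ofReal (c * 0))) :=
      ENNReal.tendsto_ofReal (tendsto_one_div_add_atTop_nhds_zero_nat.const_mul c)
    rw [mul_zero, ENNReal.ofReal_zero] at hlim
    exact nonpos_iff_eq_zero.1
      (ge_of_tendsto' hlim fun n => (measure_mono (iInter_subset B n)).trans (hB n))
  have hcount : ∀ᵐ ω ∂P, ∀ i, ∀ A, MeasurableSet A → ∃ n : ℕ∞, M i ω A = (n : ℝ≥0∞) :=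
    ae_all_iff.2 fun i => (hM i).counting
  have hnot : ∀ᵐ ω ∂P, ω ∉ ⋂ n, B n := measure_eq_zero_iff_ae_notMem.1 hnull
  filter_upwards [hcount, hnot] with ω hω hωB s
  by_cases hs : s ∈ Icc 0 T
  swap
  · simp [hsupp _ ω s hs]
  simp only [mem_iInter, not_forall] at hωB
  obtain ⟨n, hn⟩ := hωB
  have hδ : 0 < T / ((n : ℝ) + 1) := by positivity
  let k := ⌊s / (T / (n + 1))⌋₊
  have hk : k < n + 2 := by
    have h1 : s / (T / ((n : ℝ) + 1)) ≤ n + 1 := by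
      rw [div_le_iff₀ hδ]
      have : ((n : ℝ) + 1) * (T / (n + 1)) = T := by field_simp
      rw [this]; exact hs.2
    have h2 : k ≤ n + 1 := by
      refine Nat.floor_le_of_le ?_
      exact_mod_cast h1
    omega
  have hsS : Prod.fst ⁻¹' {s} ⊆ S n k := by
    rintro p rfl
    refine ⟨?_, ?_⟩
    · rw [← le_div_iff₀ hδ]
      exact Nat.floor_le (div_nonneg hs.1 hδ.le)
    · rw [← div_le_iff₀ hδ]
      exact (Nat.lt_floor_add_one _).le
  have hgood : ¬ ((∃ i, 2 ≤ M i ω (S n k)) ∨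
      ∃ i j, i ≠ j ∧ M i ω (S n k) ≠ 0 ∧ M j ω (S n k) ≠ 0) := fun h =>
    hn (mem_biUnion (Finset.mem_coe.2 (Finset.mem_range.2 hk)) h)
  push Not at hgood
  refine (Finset.sum_le_sum fun i _ => measure_mono hsS).trans ?_
  by_cases h0 : ∀ i, M i ω (S n k) = 0
  · simp [h0]
  push Not at h0
  obtain ⟨i, hi⟩ := h0
  rw [Finset.sum_eq_single i (fun j _ hj => hgood.2 i j hj.symm hi) (by simp)]
  obtain ⟨a, ha⟩ := hω i _ (hS n k)
  have hlt := hgood.1 i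
  rw [ha] at hlt ⊢
  have h2 : a < 2 := by exact_mod_cast hlt
  have h1 : a ≤ 1 := by
    rw [← one_add_one_eq_two] at h2
    exact Order.le_of_lt_add_one h2
  exact_mod_cast h1

end Simultaneous

/-! ### The driving measures of the station -/

theorem measurable_map_restrict {E F : Type*} [MeasurableSpace E] [MeasurableSpace F] {W : Set E}
    (hW : MeasurableSet W) {f : E → F} (hf : Measurable f) :
    Measurable fun N : Measure E => (N.restrict W).map f := by
  refine Measure.measurable_of_measurable_coe _ fun A hA => ?_
  simp_rw [Measure.map_apply hf hA, Measure.restrict_apply (hf hA)]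
  exact Measure.measurable_coe ((hf hA).inter hW)

/-- The window of times in `[0, T]` and heights in `[0, H]`. -/
def window (T H : ℝ) : Set (ℝ × ℝ) := Icc 0 T ×ˢ Icc 0 H

theorem measurableSet_window (T H : ℝ) : MeasurableSet (window T H) :=
  measurableSet_Icc.prod measurableSet_Icc

section Channels

variable {Ω : Type*} (D : Drivers Ω) (K : ℕ) (T : ℝ) (lam nu mu : ℝ≥0)

/-- The parts of the driving measures that can influence the station up to time `T`, as measures
on `[0, T] × ℝ₊`: the rates of reservations are at most `1`, the other ones at most `K`. The
processes on the line are placed at height `1`. -/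
def channel (ω : Ω) : Channel K → Measure (ℝ × ℝ)
  | .inl 0 => (D.lam1 ω).restrict (window T 1)
  | .inl 1 => (D.lam2 ω).restrict (window T 1)
  | .inl 2 => (D.nu1 ω).restrict (window T K)
  | .inl 3 => (D.nu2 ω).restrict (window T K)
  | .inr l => ((D.mu l ω).restrict (Icc 0 T)).map fun s => (s, (1 : ℝ))

/-- The intensities of the measures `channel`. -/
def intensity : Channel K → Measure (ℝ × ℝ)
  | .inl 0 => (planeIntensity lam).restrict (window T 1)
  | .inl 1 => (planeIntensity lam).restrict (window T 1)
  | .inl 2 => (planeIntensity nu).restrict (window T K)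
  | .inl 3 => (planeIntensity nu).restrict (window T K)
  | .inr _ => ((lineIntensity mu).restrict (Icc 0 T)).map fun s => (s, (1 : ℝ))

variable {K T lam nu mu} {D}

theorem planeIntensity_restrict_le (ξ : ℝ≥0) (H : ℝ) {A : Set (ℝ × ℝ)} (hA : MeasurableSet A) :
    (planeIntensity ξ).restrict (window T H) A ≤ ξ * volume (A ∩ window T H) := by
  rw [Measure.restrict_apply hA, planeIntensity, Measure.smul_apply, ENNReal.smul_def, smul_eq_mul]
  gcongr
  exact Measure.restrict_le_self

theorem lineIntensity_map_le (ξ : ℝ≥0) {A : Set (ℝ × ℝ)} (hA : MeasurableSet A) :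
    ((lineIntensity ξ).restrict (Icc 0 T)).map (fun s => (s, (1 : ℝ))) A ≤
      ξ * volume ({s | (s, (1 : ℝ)) ∈ A} ∩ Icc 0 T) := by
  rw [Measure.map_apply (by fun_prop) hA, Measure.restrict_apply' measurableSet_Icc, lineIntensity,
    Measure.smul_apply, ENNReal.smul_def, smul_eq_mul]
  exact mul_le_mul_right (Measure.restrict_le_self _) _

instance isFiniteMeasure_intensity (i : Channel K) : IsFiniteMeasure (intensity K T lam nu mu i) := by
  have h1 : ∀ (ξ : ℝ≥0) (H : ℝ), IsFiniteMeasure ((planeIntensity ξ).restrict (window T H)) := by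
    refine fun ξ H => ⟨(planeIntensity_restrict_le ξ H .univ).trans_lt ?_⟩
    refine ENNReal.mul_lt_top ENNReal.coe_lt_top ?_
    rw [univ_inter, window, Measure.volume_eq_prod, Measure.prod_prod]
    exact ENNReal.mul_lt_top (by simp) (by simp)
  rcases i with i | l
  · fin_cases i
    · exact h1 _ _
    · exact h1 _ _
    · exact h1 _ _
    · exact h1 _ _
  · refine ⟨(lineIntensity_map_le mu .univ).trans_lt (ENNReal.mul_lt_top ENNReal.coe_lt_top ?_)⟩
    exact (measure_mono inter_subset_right).trans_lt (by simp)

theorem intensity_strip_le (i : Channel K) (a b : ℝ) :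
    intensity K T lam nu mu i (Prod.fst ⁻¹' Icc a b) ≤
      (lam + nu * K + mu : ℝ≥0) * ENNReal.ofReal (b - a) := by
  have hplane : ∀ (ξ : ℝ≥0) (H : ℕ), (planeIntensity ξ).restrict (window T H)
      (Prod.fst ⁻¹' Icc a b) ≤ (ξ * H : ℝ≥0) * ENNReal.ofReal (b - a) := by
    intro ξ H
    refine (planeIntensity_restrict_le ξ H (measurable_fst measurableSet_Icc)).trans ?_
    have : Prod.fst ⁻¹' Icc a b ∩ window T H ⊆ Icc a b ×ˢ Icc 0 (H : ℝ) :=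
      fun p hp => ⟨hp.1, hp.2.2⟩
    refine (mul_le_mul_right (measure_mono this) _).trans_eq ?_
    rw [Measure.volume_eq_prod, Measure.prod_prod, Real.volume_Icc, Real.volume_Icc, sub_zero,
      ENNReal.ofReal_natCast, ENNReal.coe_mul, ENNReal.coe_natCast]
    ring
  have hmono : ∀ {c : ℝ≥0}, c ≤ lam + nu * K + mu →
      (c : ℝ≥0∞) * ENNReal.ofReal (b - a) ≤ (lam + nu * K + mu : ℝ≥0) * ENNReal.ofReal (b - a) :=
    fun h => mul_le_mul_left (ENNReal.coe_le_coe.2 h) _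
  have h1 : lam * (1 : ℕ) ≤ lam + nu * K + mu := by
    rw [Nat.cast_one, mul_one, add_assoc]; exact le_self_add
  have h2 : nu * K ≤ lam + nu * K + mu := (le_add_left le_rfl).trans le_self_add
  have h3 : mu ≤ lam + nu * K + mu := le_add_left le_rfl
  rcases i with i | l
  · fin_cases i
    · exact ((hplane lam 1).trans' (by simp [intensity])).trans (hmono h1)
    · exact ((hplane lam 1).trans' (by simp [intensity])).trans (hmono h1)
    · exact (hplane nu K).trans (hmono h2)
    · exact (hplane nu K).trans (hmono h2)
  · refine ((lineIntensity_map_le mu (measurable_fst measurableSet_Icc)).trans ?_).trans (hmono h3)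
    refine mul_le_mul_right ?_ _
    rw [← Real.volume_Icc]
    exact measure_mono fun s hs => hs.1

theorem intensity_height_zero (i : Channel K) :
    intensity K T lam nu mu i (Prod.snd ⁻¹' {0}) = 0 := by
  have hm : MeasurableSet (Prod.snd ⁻¹' {0} : Set (ℝ × ℝ)) :=
    measurable_snd (measurableSet_singleton 0)
  have hplane : ∀ (ξ : ℝ≥0) (H : ℝ), (planeIntensity ξ).restrict (window T H)
      (Prod.snd ⁻¹' {0}) = 0 := by
    intro ξ H
    refine nonpos_iff_eq_zero.1 ((planeIntensity_restrict_le ξ H hm).trans_eq ?_)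
    have : (Prod.snd ⁻¹' {0} : Set (ℝ × ℝ)) ∩ window T H ⊆ univ ×ˢ {0} := fun p hp => ⟨trivial, hp.1⟩
    rw [measure_mono_null this (by rw [Measure.volume_eq_prod, Measure.prod_prod]; simp), mul_zero]
  rcases i with i | l
  · fin_cases i <;> exact hplane _ _
  · exact nonpos_iff_eq_zero.1 ((lineIntensity_map_le mu hm).trans_eq (by simp))

theorem planeIntensity_restrict_le_volume (ξ : ℝ≥0) (H : ℝ) {A : Set (ℝ × ℝ)} (hA : MeasurableSet A) :
    (planeIntensity ξ).restrict (window T H) A ≤ ξ * volume A :=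
  (planeIntensity_restrict_le ξ H hA).trans (mul_le_mul_right (measure_mono inter_subset_left) _)

theorem channel_fst_eq_zero (i : Channel K) (ω : Ω) {s : ℝ} (hs : s ∉ Icc 0 T) :
    channel D K T ω i (Prod.fst ⁻¹' {s}) = 0 := by
  have hplane : ∀ (N : Measure (ℝ × ℝ)) (H : ℝ),
      N.restrict (window T H) (Prod.fst ⁻¹' {s}) = 0 := by
    intro N H
    rw [Measure.restrict_apply' (measurableSet_window T H)]
    refine measure_mono_null (t := ∅) ?_ measure_empty
    rintro p ⟨hp, hp'⟩
    exact hs ((show p.1 = s from hp) ▸ hp'.1)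
  rcases i with i | l
  · fin_cases i <;> exact hplane _ _
  · rw [channel, Measure.map_apply (by fun_prop) (measurable_fst (measurableSet_singleton s)),
      Measure.restrict_apply' measurableSet_Icc]
    refine measure_mono_null (t := ∅) ?_ measure_empty
    rintro u ⟨hu, hu'⟩
    exact hs ((show u = s from hu) ▸ hu')

variable [MeasurableSpace Ω] {P : Measure Ω}

theorem Drivers.IsPoisson.channel (hD : D.IsPoisson P lam nu mu) (i : Channel K) :
    IsPoissonProcess P (fun ω => channel D K T ω i) (intensity K T lam nu mu i) := by
  have hplane : ∀ {N : Ω → Measure (ℝ × ℝ)} {m : Measure (ℝ × ℝ)} (H : ℝ),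
      IsPoissonProcess P N m →
      IsPoissonProcess P (fun ω => (N ω).restrict (window T H)) (m.restrict (window T H)) := by
    intro N m H h
    simpa using h.map_restrict (measurableSet_window T H) measurable_id
  rcases i with i | l
  · fin_cases i
    · exact hplane 1 hD.lam1
    · exact hplane 1 hD.lam2
    · exact hplane K hD.nu1
    · exact hplane K hD.nu2
  · exact (hD.mu l).map_restrict measurableSet_Icc (by fun_prop)

theorem Drivers.IsPoisson.iIndepFun_channel (hD : D.IsPoisson P lam nu mu) :
    iIndepFun (fun (i : Channel K) ω => CarSharing.channel D K T ω i) P := by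
  rw [iIndepFun_iff_iIndep]
  have hinj : Function.Injective (Sum.map id Fin.val : Channel K → Fin 4 ⊕ ℕ) :=
    Function.injective_id.sumMap Fin.val_injective
  refine iIndep_of_iIndep_of_le (hD.indep.precomp hinj) fun i => ?_
  have hplane : ∀ (N : Ω → Measure (ℝ × ℝ)) (H : ℝ),
      MeasurableSpace.comap (fun ω => (N ω).restrict (window T H)) inferInstance ≤
        MeasurableSpace.comap N inferInstance := by
    intro N H
    have h : Measurable fun M : Measure (ℝ × ℝ) => M.restrict (window T H) := by
      simpa using measurable_map_restrict (measurableSet_window T H) measurable_id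
    exact (h.comp (comap_measurable N)).comap_le
  rcases i with i | l
  · fin_cases i
    · exact hplane D.lam1 1
    · exact hplane D.lam2 1
    · exact hplane D.nu1 K
    · exact hplane D.nu2 K
  · exact ((measurable_map_restrict measurableSet_Icc (by fun_prop)).comp
      (comap_measurable (D.mu l))).comap_le

theorem Drivers.IsPoisson.measurable_channel (hD : D.IsPoisson P lam nu mu) :
    Measurable (CarSharing.channel D K T) :=
  measurable_pi_lambda _ fun i => (hD.channel i).measurable

theorem Drivers.IsPoisson.gapBound (hD : D.IsPoisson P lam nu mu) :
    GapBound P (CarSharing.channel D K T) lam := fun _ hB =>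
  ⟨((hD.channel (.inl 0)).measure_ne_zero_le hB (measure_ne_top _ _)).trans
      (planeIntensity_restrict_le_volume lam 1 hB),
    ((hD.channel (.inl 1)).measure_ne_zero_le hB (measure_ne_top _ _)).trans
      (planeIntensity_restrict_le_volume lam 1 hB)⟩

theorem Drivers.IsPoisson.ae_isSimple (hD : D.IsPoisson P lam nu mu) (hT : 0 < T) :
    ∀ᵐ ω ∂P, IsSimple (CarSharing.channel D K T ω) := by
  have hfin : ∀ᵐ ω ∂P, ∀ i, CarSharing.channel D K T ω i univ ≠ ∞ :=
    ae_all_iff.2 fun i => (hD.channel i).ae_ne_top .univ (measure_ne_top _ _)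
  have hcount : ∀ᵐ ω ∂P, ∀ i, ∀ A, MeasurableSet A →
      ∃ n : ℕ∞, CarSharing.channel D K T ω i A = (n : ℝ≥0∞) :=
    ae_all_iff.2 fun i => (hD.channel i).counting
  have htime : ∀ᵐ ω ∂P, ∀ i, CarSharing.channel D K T ω i (Prod.fst ⁻¹' {0}) = 0 := by
    refine ae_all_iff.2 fun i => (hD.channel i).ae_eq_zero
      (measurable_fst (measurableSet_singleton 0)) ?_
    have := intensity_strip_le (T := T) (lam := lam) (nu := nu) (mu := mu) i 0 0
    simpa using this
  have hheight : ∀ᵐ ω ∂P, ∀ i, CarSharing.channel D K T ω i (Prod.snd ⁻¹' {0}) = 0 :=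
    ae_all_iff.2 fun i => (hD.channel i).ae_eq_zero
      (measurable_snd (measurableSet_singleton 0)) (intensity_height_zero i)
  have hsimple := ae_sum_le_one hD.channel hD.iIndepFun_channel hT
    (fun i a b => intensity_strip_le (K := K) i a b) fun i ω s hs => channel_fst_eq_zero i ω hs
  filter_upwards [hfin, hcount, htime, hheight, hsimple] with ω h1 h2 h3 h4 h5
  refine ⟨fun i => ⟨(h1 i).lt_top⟩, fun i A hA => ?_, h3, h4, h5⟩
  obtain ⟨n, hn⟩ := h2 i A hA
  have hne : CarSharing.channel D K T ω i A ≠ ∞ :=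
    ((measure_mono (subset_univ A)).trans_lt (h1 i).lt_top).ne
  cases n with
  | top => exact absurd hn hne
  | coe n => exact ⟨n, by simpa using hn⟩

/-- The law of the driving measures is determined by the intensities. -/
theorem Drivers.IsPoisson.map_channel_eq [IsProbabilityMeasure P] {Ω' : Type*} [MeasurableSpace Ω']
    {P' : Measure Ω'} [IsProbabilityMeasure P'] {D' : Drivers Ω'}
    (hD : D.IsPoisson P lam nu mu) (hD' : D'.IsPoisson P' lam nu mu) :
    P.map (CarSharing.channel D K T) = P'.map (CarSharing.channel D' K T) := by
  have h := (iIndepFun_iff_map_fun_eq_pi_map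
    (fun i => (hD.channel (K := K) (T := T) i).measurable.aemeasurable)).1 hD.iIndepFun_channel
  have h' := (iIndepFun_iff_map_fun_eq_pi_map
    (fun i => (hD'.channel (K := K) (T := T) i).measurable.aemeasurable)).1 hD'.iIndepFun_channel
  refine h.trans (Eq.trans ?_ h'.symm)
  congr 1
  ext1 i
  exact (hD.channel i).map_eq (hD'.channel i)

/-- The mean-field functions `ℙ(V(s-) > 0)` and `ℙ(S(s-) < K)` of a process. -/
def leftMeanField (P : Measure Ω) (K : ℕ) (Z : ℝ → Ω → State) (s : ℝ) : ℝ × ℝ :=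
  meanField P K fun ω => before (fun u => Z u ω) s

theorem restrict_window_hits (N : Measure (ℝ × ℝ)) {c : ℝ → ℝ} {H t : ℝ} (ht : t ≤ T)
    (hc : ∀ s ∈ Icc 0 T, c s ≤ H) : N.restrict (window T H) (hits c (Icc 0 t)) = thinned N c t := by
  rw [Measure.restrict_apply' (measurableSet_window T H), thinned]
  congr 1
  ext p
  constructor
  · rintro ⟨hp, -⟩
    exact ⟨hp.1.1, hp.1.2, hp.2.1, hp.2.2⟩
  · rintro ⟨h1, h2, h3, h4⟩
    exact ⟨⟨⟨h1, h2⟩, h3, h4⟩, ⟨h1, h2.trans ht⟩, h3, h4.trans (hc _ ⟨h1, h2.trans ht⟩)⟩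

/-- At height `1`, a rate `1` or `0` decides whether a point counts. -/
theorem map_line_hits (N : Measure ℝ) (l : ℕ) (y : ℝ → State) {t : ℝ} (ht : t ≤ T) :
    (N.restrict (Icc 0 T)).map (fun s => (s, (1 : ℝ)))
      (hits (fun s => if l + 1 ≤ y s 1 then 1 else 0) (Icc 0 t)) =
    N {s | 0 ≤ s ∧ s ≤ t ∧ l + 1 ≤ y s 1} := by
  rw [MeasurableEmbedding.map_apply (measurableEmbedding_prod_mk_right (1 : ℝ)),
    Measure.restrict_apply' measurableSet_Icc]
  congr 1
  ext s
  constructor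
  · rintro ⟨⟨h1, -, h3⟩, -⟩
    refine ⟨h1.1, h1.2, ?_⟩
    by_contra hn
    simp only [if_neg hn] at h3
    linarith
  · rintro ⟨h1, h2, h3⟩
    exact ⟨⟨⟨h1, h2⟩, zero_le_one, by simp [h3]⟩, h1, h2.trans ht⟩

variable {Z : ℝ → Ω → State} {ω : Ω} {t : ℝ}

section Bridge

variable [IsProbabilityMeasure P]

theorem le_of_mem_chi {q : State} (hq : q ∈ chi K) (k : Fin 4) : q k ≤ K :=
  (Finset.single_le_sum (f := q) (fun _ _ => Nat.zero_le _) (Finset.mem_univ k)).trans hq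

/-- The stochastic integrals of the evolution equations, in terms of the measures `channel`. -/
theorem integrals_eq (hc : IsCadlagOn T fun u => Z u ω) (hchi : ∀ u ∈ Icc 0 T, Z u ω ∈ chi K)
    (ht : t ≤ T) :
    let H := fun i : Channel K => channel D K T ω i (hits (fun s =>
      stationRate K (leftMeanField P K Z) i s (before (fun u => Z u ω) s)) (Icc 0 t))
    spaceReservations P D K Z ω t = H (.inl 0) ∧ carReservations P D K Z ω t = H (.inl 1) ∧
      departuresToStation D Z ω t = H (.inl 2) ∧ pickUps D Z ω t = H (.inl 3) ∧
      returns D Z ω t = ∑ l, H (.inr l) := by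
  have hb : ∀ s ∈ Icc 0 T, before (fun u => Z u ω) s ∈ chi K := fun s hs =>
    before_mem_chi hc hchi hs
  refine ⟨?_, ?_, ?_, ?_, ?_⟩
  · refine (restrict_window_hits _ ht fun s _ => ?_).symm
    change (if _ then _ else _ : ℝ) ≤ 1
    split_ifs
    · exact measureReal_le_one
    · exact zero_le_one
  · refine (restrict_window_hits _ ht fun s _ => ?_).symm
    change (if _ then _ else _ : ℝ) ≤ 1
    split_ifs
    · exact measureReal_le_one
    · exact zero_le_one
  · refine (restrict_window_hits _ ht fun s hs => ?_).symm
    exact Nat.cast_le.2 (le_of_mem_chi (hb s hs) 0)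
  · refine (restrict_window_hits _ ht fun s hs => ?_).symm
    exact Nat.cast_le.2 (le_of_mem_chi (hb s hs) 3)
  · rw [returns, tsum_eq_sum (s := Finset.range K), Finset.sum_range]
    · exact Finset.sum_congr rfl fun l _ => (map_line_hits _ _ _ ht).symm
    · intro l hl
      refine measure_mono_null (t := ∅) ?_ measure_empty
      rintro s ⟨h1, h2, h3⟩
      have := le_of_mem_chi (hb s ⟨h1, h2.trans ht⟩) 1
      have := Finset.mem_range.not.1 hl
      omega

/-- The evolution equations, in terms of the measures `channel`. -/
theorem equations_iff (hfin : ∀ i, IsFiniteMeasure (channel D K T ω i))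
    (hc : IsCadlagOn T fun u => Z u ω) (hchi : ∀ u ∈ Icc 0 T, Z u ω ∈ chi K) (ht : t ≤ T)
    (q : State) :
    ((Z t ω 0 : ℝ) = q 0 + (spaceReservations P D K Z ω t).toReal
        - (departuresToStation D Z ω t).toReal ∧
      (Z t ω 1 : ℝ) = q 1 + (departuresToStation D Z ω t).toReal - (returns D Z ω t).toReal ∧
      (Z t ω 2 : ℝ) = q 2 + (returns D Z ω t).toReal - (carReservations P D K Z ω t).toReal ∧
      (Z t ω 3 : ℝ) = q 3 + (carReservations P D K Z ω t).toReal - (pickUps D Z ω t).toReal) ↔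
    ∀ k, (Z t ω k : ℝ) = (station K q (leftMeanField P K Z)).reached (channel D K T ω)
      (before fun u => Z u ω) (Icc 0 t) k := by
  obtain ⟨h0, h1, h2, h3, h4⟩ := integrals_eq (P := P) (D := D) hc hchi ht
  rw [h0, h1, h2, h3, h4, ENNReal.toReal_sum fun l _ => measure_ne_top _ _]
  simp only [Fin.forall_fin_succ, Dynamics.reached, Fintype.sum_sum_type, Fin.sum_univ_four]
  simp [station, stationJump, Finset.sum_neg_distrib, sub_eq_add_neg, add_assoc]
  intro _ _ _
  rw [add_comm (∑ _, _)]

theorem integrals_ne_top (hfin : ∀ i, IsFiniteMeasure (channel D K T ω i))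
    (hc : IsCadlagOn T fun u => Z u ω) (hchi : ∀ u ∈ Icc 0 T, Z u ω ∈ chi K) (ht : t ≤ T) :
    spaceReservations P D K Z ω t ≠ ∞ ∧ departuresToStation D Z ω t ≠ ∞ ∧
      returns D Z ω t ≠ ∞ ∧ carReservations P D K Z ω t ≠ ∞ ∧ pickUps D Z ω t ≠ ∞ := by
  obtain ⟨h0, h1, h2, h3, h4⟩ := integrals_eq (P := P) (D := D) hc hchi ht
  rw [h0, h1, h2, h3, h4]
  exact ⟨measure_ne_top _ _, measure_ne_top _ _,
    (ENNReal.sum_lt_top.2 fun l _ => measure_lt_top _ _).ne, measure_ne_top _ _, measure_ne_top _ _⟩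

end Bridge

end Channels

/-! ### Solutions of the system -/

section Solutions

variable {Ω : Type*} [MeasurableSpace Ω] {P : Measure Ω} [IsProbabilityMeasure P] {D : Drivers Ω}
  {K : ℕ} {T : ℝ} {lam nu mu : ℝ≥0} {q : State}

/-- Mean-field functions that are self-consistent for the law of the driving measures yield a
solution. -/
theorem Drivers.IsPoisson.exists_isSolution (hD : D.IsPoisson P lam nu mu) (hT : 0 < T)
    (hq : q ∈ chi K) {ρ : ℝ → ℝ × ℝ} (hρ : Measurable ρ)
    (hfix : meanFieldMap (P.map (CarSharing.channel D K T)) q ρ = ρ) :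
    ∃ Z : ℝ → Ω → State, IsSolution P D K T q Z ∧ ∀ᵐ ω ∂P, ∀ t,
      Z t ω = (station K q ρ).path (fun i => cut (CarSharing.channel D K T ω i)) t := by
  classical
  have hM := hD.measurable_channel (K := K) (T := T)
  have hrate := measurable_stationRate (K := K) q hρ
  -- on a measurable null set that contains all exceptional `ω`, the paths are constant
  set bad : Set Ω := toMeasurable P {ω | ¬ IsSimple (CarSharing.channel D K T ω)} with hbad
  have hbadm : MeasurableSet bad := measurableSet_toMeasurable _ _
  have hbad0 : P bad = 0 := by
    rw [hbad, measure_toMeasurable]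
    exact ae_iff.1 (hD.ae_isSimple hT)
  have hgood : ∀ ω ∉ bad, IsSimple (CarSharing.channel D K T ω) := fun ω hω => by
    by_contra h
    exact hω (subset_toMeasurable _ _ h)
  have hae : ∀ᵐ ω ∂P, ω ∉ bad := measure_eq_zero_iff_ae_notMem.1 hbad0
  have hcut : ∀ ω ∉ bad, (fun i => cut (CarSharing.channel D K T ω i)) =
      CarSharing.channel D K T ω := fun ω hω => funext fun i => by
    have := (hgood ω hω).finite i
    exact cut_eq _
  let Z : ℝ → Ω → State := fun t ω => if ω ∈ bad then q else
    (station K q ρ).path (fun i => cut (CarSharing.channel D K T ω i)) t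
  have hZbad : ∀ ω ∈ bad, (fun t => Z t ω) = fun _ => q := fun ω hω => funext fun t => if_pos hω
  have hZ : ∀ ω ∉ bad, (fun t => Z t ω) = (station K q ρ).path (CarSharing.channel D K T ω) :=
    fun ω hω => funext fun t => (if_neg hω).trans (by rw [hcut ω hω])
  have hchi : ∀ ω t, Z t ω ∈ chi K := by
    intro ω t
    by_cases hω : ω ∈ bad
    · rw [show Z t ω = q from if_pos hω]; exact hq
    · rw [show Z t ω = _ from if_neg hω]; exact clip_mem_chi _ _
  have hcad : ∀ ω, IsCadlagOn T fun t => Z t ω := by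
    intro ω
    by_cases hω : ω ∈ bad
    · rw [hZbad ω hω]
      exact ⟨fun t _ => continuousWithinAt_const, fun t _ => ⟨q, tendsto_const_nhds⟩⟩
    · rw [hZ ω hω]; exact (hgood ω hω).path_cadlag T
  -- the mean field of `Z` is `ρ`, because `ρ` is self-consistent
  have hmf : ∀ s, 0 ≤ s → leftMeanField P K Z s = ρ s := by
    intro s hs
    have hset : ∀ B : Set State, P.real {ω | before (fun u => Z u ω) s ∈ B} =
        (P.map (CarSharing.channel D K T)).real
          {M | (station K q ρ).leftPath (fun i => cut (M i)) s ∈ B} := by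
      intro B
      have hB : MeasurableSet {M : Channel K → Measure (ℝ × ℝ) |
          (station K q ρ).leftPath (fun i => cut (M i)) s ∈ B} :=
        ((measurable_leftPath hrate).comp (measurable_prodMk_right (y := s)))
          (Set.to_countable B).measurableSet
      rw [map_measureReal_apply hM hB]
      refine measureReal_congr ?_
      filter_upwards [hae] with ω hω
      have : before (fun u => Z u ω) s =
          (station K q ρ).leftPath (fun i => cut (CarSharing.channel D K T ω i)) s := by
        rw [hZ ω hω, (hgood ω hω).before_path hs, hcut ω hω]
      exact propext (by
        change before (fun u => Z u ω) s ∈ B ↔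
          (station K q ρ).leftPath (fun i => cut (CarSharing.channel D K T ω i)) s ∈ B
        rw [this])
    rw [← congrFun hfix s]
    exact Prod.ext (hset {x | 0 < x 2}) (hset {x | total x < K})
  refine ⟨Z, ⟨?_, fun ω t _ => hchi ω t, hcad, ?_, ?_⟩, ?_⟩
  · intro t _
    exact Measurable.ite hbadm measurable_const ((measurable_path hrate t).comp hM)
  · filter_upwards [hae] with ω hω t ht
    exact integrals_ne_top (hgood ω hω).finite (hcad ω) (fun u _ => hchi ω u) ht.2
  · filter_upwards [hae] with ω hω t ht
    rw [equations_iff (hgood ω hω).finite (hcad ω) (fun u _ => hchi ω u) ht.2]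
    intro k
    rw [reached_station_congr (hgood ω hω).times_zero (ρ' := ρ) fun u hu => hmf u hu.1.le,
      hZ ω hω, ← (hgood ω hω).path_eq (station_admissible hq ρ) ht.1]
    exact congrArg (fun x : State => (x k : ℝ)) (congrFun (hZ ω hω) t)
  · filter_upwards [hae] with ω hω t
    exact if_neg hω

/-- Pathwise uniqueness. -/
theorem IsSolution.ae_eq (hD : D.IsPoisson P lam nu mu) (hT : 0 < T) {Z Z' : ℝ → Ω → State}
    (h : IsSolution P D K T q Z) (h' : IsSolution P D K T q Z') :
    ∀ᵐ ω ∂P, ∀ t ∈ Icc 0 T, Z t ω = Z' t ω := by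
  have hsimple := hD.ae_isSimple (K := K) hT
  have aux : ∀ {Z : ℝ → Ω → State}, IsSolution P D K T q Z → ∀ᵐ ω ∂P, ∀ t ∈ Icc 0 T, ∀ k,
      (Z t ω k : ℝ) = (station K q (leftMeanField P K Z)).reached (CarSharing.channel D K T ω)
        (before fun u => Z u ω) (Icc 0 t) k := by
    intro Z h
    filter_upwards [hsimple, h.equations] with ω hω he t ht
    exact (equations_iff hω.finite (h.cadlag ω) (h.mem_chi ω) ht.2 q).1 (he t ht)
  exact hD.gapBound.ae_eq (hsimple.mono fun ω hω => hω.times_zero) h.measurable h'.measurable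
    h.cadlag h'.cadlag (aux h) (aux h')

/-- Self-consistent mean-field functions exist, for the law of the driving measures. -/
theorem Drivers.IsPoisson.exists_selfConsistent (hD : D.IsPoisson P lam nu mu) (K : ℕ) (T : ℝ)
    (q : State) : ∃ ρ : ℝ → ℝ × ℝ, Measurable ρ ∧
      meanFieldMap (P.map (CarSharing.channel D K T)) q ρ = ρ := by
  have hM := hD.measurable_channel (K := K) (T := T)
  have : IsProbabilityMeasure (P.map (CarSharing.channel D K T)) :=
    Measure.isProbabilityMeasure_map hM.aemeasurable
  refine GapBound.exists_meanField (lam := lam) (fun B hB => ?_) q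
  have h := hD.gapBound (K := K) (T := T) B hB
  have hmap : ∀ i, P.map (CarSharing.channel D K T) {M | id M i B ≠ 0} =
      P {ω | CarSharing.channel D K T ω i B ≠ 0} := fun i =>
    Measure.map_apply hM (((Measure.measurable_coe hB).comp (measurable_pi_apply i))
      (measurableSet_singleton 0).compl)
  rw [hmap, hmap]
  exact h

/-- The law of a solution is the image, under a deterministic map, of the law of the driving
measures. -/
theorem IsSolution.pathLaw_eq (hD : D.IsPoisson P lam nu mu) (hT : 0 < T) (hq : q ∈ chi K)
    {ρ : ℝ → ℝ × ℝ} (hρ : Measurable ρ)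
    (hfix : meanFieldMap (P.map (CarSharing.channel D K T)) q ρ = ρ) {Z : ℝ → Ω → State}
    (h : IsSolution P D K T q Z) :
    pathLaw P T Z = (P.map (CarSharing.channel D K T)).map
      fun M (t : Icc (0 : ℝ) T) => (station K q ρ).path (fun i => cut (M i)) t := by
  obtain ⟨Z', hZ', hpath⟩ := hD.exists_isSolution hT hq hρ hfix
  have hpathm : Measurable fun (M : Channel K → Measure (ℝ × ℝ)) (t : Icc (0 : ℝ) T) =>
      (station K q ρ).path (fun i => cut (M i)) t :=
    measurable_pi_lambda _ fun t => measurable_path (measurable_stationRate q hρ) t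
  rw [Measure.map_map hpathm hD.measurable_channel]
  refine Measure.map_congr ?_
  filter_upwards [h.ae_eq hD hT hZ', hpath] with ω h1 h2
  ext1 t
  rw [h1 t t.2, h2 t]
  rfl

end Solutions

end CarSharing

end

theorem theorem1 (K : ℕ) (lam nu mu : ℝ≥0) (hlam : 0 < lam) (hnu : 0 < nu) (hmu : 0 < mu)
    (T : ℝ) (hT : 0 < T) (w x y z : ℕ) (hq : ![w, x, y, z] ∈ CarSharing.chi K) :
    -- existence and pathwise uniqueness, for all given driving Poisson processes
    (∀ (Ω : Type*) [MeasurableSpace Ω] (P : Measure Ω) [IsProbabilityMeasure P]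
      (D : CarSharing.Drivers Ω), D.IsPoisson P lam nu mu →
        (∃ Z : ℝ → Ω → CarSharing.State, CarSharing.IsSolution P D K T ![w, x, y, z] Z) ∧
        (∀ Z Z' : ℝ → Ω → CarSharing.State,
          CarSharing.IsSolution P D K T ![w, x, y, z] Z →
          CarSharing.IsSolution P D K T ![w, x, y, z] Z' →
          ∀ᵐ ω ∂P, ∀ t ∈ Icc 0 T, Z t ω = Z' t ω)) ∧
    -- uniqueness of the law of the solution
    (∀ (Ω : Type*) [MeasurableSpace Ω] (P : Measure Ω) [IsProbabilityMeasure P]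
      (D : CarSharing.Drivers Ω) (Z : ℝ → Ω → CarSharing.State)
      (Ω' : Type*) [MeasurableSpace Ω'] (P' : Measure Ω') [IsProbabilityMeasure P']
      (D' : CarSharing.Drivers Ω') (Z' : ℝ → Ω' → CarSharing.State),
        D.IsPoisson P lam nu mu → CarSharing.IsSolution P D K T ![w, x, y, z] Z →
        D'.IsPoisson P' lam nu mu → CarSharing.IsSolution P' D' K T ![w, x, y, z] Z' →
        CarSharing.pathLaw P T Z = CarSharing.pathLaw P' T Z') := by
  refine ⟨fun Ω _ P _ D hD => ⟨?_, fun Z Z' h h' => h.ae_eq hD hT h'⟩,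
    fun Ω _ P _ D Z Ω' _ P' _ D' Z' hD h hD' h' => ?_⟩
  · obtain ⟨ρ, hρ, hfix⟩ := hD.exists_selfConsistent K T ![w, x, y, z]
    obtain ⟨Z, hZ, -⟩ := hD.exists_isSolution hT hq hρ hfix
    exact ⟨Z, hZ⟩
  · obtain ⟨ρ, hρ, hfix⟩ := hD.exists_selfConsistent K T ![w, x, y, z]
    have hlaw := hD.map_channel_eq (K := K) (T := T) hD'
    rw [h.pathLaw_eq hD hT hq hρ hfix, h'.pathLaw_eq hD' hT hq hρ (hlaw ▸ hfix), hlaw]
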